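/- Let $n\ge 1$ be an integer, $0<\gamma<n$, $m=[n/2]$, and consider, for $\varepsilon>0$, the Cauchy problem on ${\bf R}^n\times[0,T)$ with scale-invariant damping $$\partial_t^2 v-\Delta v+\frac{2}{1+t}\partial_t v=(|x|^{-\gamma}*v^2)\,v,\qquad v(x,0)=0,\quad \partial_t v(x,0)=\varepsilon g(x),$$ with $g:{\bf R}^n\to{\bf R}$ continuous and the convolution taken in $x$. Solutions are understood through $u=(1+t)v$: a function $u$ is a solution on ${\bf R}^n\times[0,T)$, $T\in(0,\infty]$, if $u\in C({\bf R}^n\times[0,T))$, the convolution $|x|^{-\gamma}*u^2$ converges absolutely at every point, $F:=(|x|^{-\gamma}*u^2)u\in C({\bf R}^n\times[0,T))$, and at every point of ${\bf R}^n\times[0,T)$ all expressions in the integral equation $$u(x,t)=\varepsilon\, W(g|x,t)+\int_0^t W\Big(\frac{F(\cdot,s)}{(1+s)^2}\Big|\,x,t-s\Big)ds$$ are well defined and the equation holds. Here $W$ is the solution operator of the free wave equation: $W(\phi|x,t)=\frac12\int_{x-t}^{x+t}\phi(y)\,dy$ if $n=1$, and for $n\ge 2$ $$W(\phi|x,t)=\frac{1}{(2m-1)!!}\Big(\frac1t\frac{\partial}{\partial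 t}\Big)^{m-1}\big\{t^{2m-1}M(\phi|x,t)\big\}\ (t>0),\qquad W(\phi|x,0)=0,$$ where, with $\omega_k=2\pi^{k/2}/\Gamma(k/2)$, $M(\phi|x,t)=\frac1{\omega_n}\int_{|\omega|=1}\phi(x+t\omega)\,dS_\omega$ if $n=2m+1$ and $M(\phi|x,t)=\frac{2}{\omega_{n+1}}\int_{|\xi|\le1}\frac{\phi(x+t\xi)}{\sqrt{1-|\xi|^2}}\,d\xi$ if $n=2m$; the derivatives are classical. The lifespan is $$T_\varepsilon:=\sup\{T\in(0,\infty]:\ \text{there exists a unique solution } u \text{ on } {\bf R}^n\times[0,T)\},\qquad \sup\emptyset:=0 .$$ Theorem (upper estimate of the lifespan for slowly decaying small data). Let $n\ge1$, $\gamma\in(0,n)$, $\nu\in\big(0,\frac{n-\gamma}2\big)$, $R>0$, $A>0$, and let $g\in C({\bf R}^n)$ be radially symmetric if $n\ge2$ and satisfy $$g(x)\ge\frac{A}{(1+|x|)^{1+\nu}}\qquad\text{for all } x\in{\bf R}^n \text{ with } |x|\ge R .$$ Then there exist constants $\varepsilon_0=\varepsilon_0(A,g,\gamma,n,R)>0$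 and $B=B(A,g,\gamma,n)>0$, depending only on the quantities displayed, such that $$T_\varepsilon\le B\,\varepsilon^{-\frac{2}{n-\gamma-2\nu}}\qquad\text{for all } 0<\varepsilon\le\varepsilon_0 .$$ -/

import Mathlib

open MeasureTheory

noncomputable section

namespace ConvWave

/-- The space `ℝⁿ` with its Euclidean norm and Lebesgue measure. -/
abbrev E (n : ℕ) : Type := EuclideanSpace ℝ (Fin n)

/-- `ω_n = 2 π^{n/2} / Γ(n/2)`, the area of the unit sphere of `ℝⁿ`. -/
def sphereArea (n : ℕ) : ℝ :=
  2 * Real.pi ^ ((n : ℝ) / 2) / Real.Gamma ((n : ℝ) / 2)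

/-- The mean `M(φ|x,t)`: for odd `n` the average of `φ` over the sphere of radius `|t|` about `x`
(`toSphere` is the surface measure of the unit sphere), for even `n` the average over the ball with
the weight `1 / √(1 - |ξ|²)`. -/
def mean (n : ℕ) (φ : E n → ℝ) (x : E n) (t : ℝ) : ℝ :=
  if Odd n then
    (1 / sphereArea n) *
      ∫ ω : Metric.sphere (0 : E n) 1, φ (x + t • (ω : E n)) ∂(volume : Measure (E n)).toSphere
  else
    (2 / sphereArea (n + 1)) *
      ∫ ξ in Metric.closedBall (0 : E n) 1, φ (x + t • ξ) / Real.sqrt (1 - ‖ξ‖ ^ 2)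

/-- The operator `ψ ↦ (1/t) ∂ψ/∂t`. -/
def radialDeriv (ψ : ℝ → ℝ) (t : ℝ) : ℝ := (1 / t) * deriv ψ t

/-- `t ↦ t^{2m-1} M(φ|x,t)` with `m = [n/2]`. -/
def weightedMean (n : ℕ) (φ : E n → ℝ) (x : E n) (t : ℝ) : ℝ :=
  t ^ (2 * (n / 2) - 1) * mean n φ x t

/-- The solution operator `W(φ|x,t)` of the free wave equation (initial displacement `0`, initial
velocity `φ`). For `n = 1` it is `½ ∫_{x-t}^{x+t} φ(y) dy`; for `n ≥ 2`, with `m = [n/2]`, it is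
`1/(2m-1)!! ((1/t) ∂_t)^{m-1} {t^{2m-1} M(φ|x,t)}`. The value at `t = 0` is `0`. -/
def waveOp : (n : ℕ) → (E n → ℝ) → E n → ℝ → ℝ
  | 1, φ, x, t => (1 / 2) * ∫ y in (x 0 - t)..(x 0 + t), φ (EuclideanSpace.single 0 y)
  | n, φ, x, t =>
      (1 / (Nat.doubleFactorial (2 * (n / 2) - 1) : ℝ)) *
        (radialDeriv^[n / 2 - 1] (weightedMean n φ x)) t

/-- The derivatives in the formula for `W(φ|x,t)` exist (classically) at the time `t`.
There is nothing to check for `n ≤ 3`. -/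
def WaveOpDefinedAt (n : ℕ) (φ : E n → ℝ) (x : E n) (t : ℝ) : Prop :=
  ∀ j < n / 2 - 1, DifferentiableAt ℝ (radialDeriv^[j] (weightedMean n φ x)) t

/-- The free evolution `u⁰(x,t) = ∂_t W(f|x,t) + W(f+g|x,t)`. -/
def freeSol (n : ℕ) (f g : E n → ℝ) (x : E n) (t : ℝ) : ℝ :=
  deriv (fun τ => waveOp n f x τ) t + waveOp n (fun y => f y + g y) x t

/-- The convolution `(V_γ * u²)(x,t)` in the space variable, with `V_γ(x) = |x|^{-γ}`. -/
def potential (n : ℕ) (γ : ℝ) (u : E n → ℝ → ℝ) (x : E n) (t : ℝ) : ℝ :=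
  ∫ y : E n, ‖x - y‖ ^ (-γ) * (u y t) ^ 2

/-- The nonlinearity `(V_γ * u²) u`. -/
def nonlin (n : ℕ) (γ : ℝ) (u : E n → ℝ → ℝ) (x : E n) (t : ℝ) : ℝ :=
  potential n γ u x t * u x t

/-- The integrand `W(F(·,s)/(1+s)² | x, t-s)` of the Duhamel operator `L`. -/
def duhamelIntegrand (n : ℕ) (F : E n → ℝ → ℝ) (x : E n) (t s : ℝ) : ℝ :=
  waveOp n (fun y => F y s / (1 + s) ^ 2) x (t - s)

/-- `L(F)(x,t) = ∫₀ᵗ W(F(·,s)/(1+s)² | x, t-s) ds`. -/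
def duhamel (n : ℕ) (F : E n → ℝ → ℝ) (x : E n) (t : ℝ) : ℝ :=
  ∫ s in (0 : ℝ)..t, duhamelIntegrand n F x t s

/-- The times `t ∈ [0,T)`, for `T ∈ (0,∞]`. -/
def times (T : ENNReal) : Set ℝ := {t | 0 ≤ t ∧ ENNReal.ofReal t < T}

/-- `u` is a solution on `ℝⁿ × [0,T)` of
`∂_t² u - Δu = (V_γ * u²) u / (1+t)²`, `u(·,0) = ε f`, `∂_t u(·,0) = ε (f + g)`:
`u` is continuous on `ℝⁿ × [0,T)`, the nonlinearity is a well-defined element of the domain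
`C(ℝⁿ × [0,T))` of `L`, every term of the integral equation `u = ε u⁰ + L((V_γ * u²) u)` makes
sense, and this equation holds at every point. Values of `u` outside `[0,T)` play no role. -/
structure IsSolution (n : ℕ) (γ : ℝ) (f g : E n → ℝ) (ε : ℝ) (T : ENNReal)
    (u : E n → ℝ → ℝ) : Prop where
  continuousOn : ContinuousOn (fun p : E n × ℝ => u p.1 p.2) (Set.univ ×ˢ times T)
  convolution_exists : ∀ x : E n, ∀ t ∈ times T,
    Integrable (fun y : E n => ‖x - y‖ ^ (-γ) * (u y t) ^ 2)
  nonlin_continuousOn :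
    ContinuousOn (fun p : E n × ℝ => nonlin n γ u p.1 p.2) (Set.univ ×ˢ times T)
  free_defined : ∀ x : E n, ∀ t ∈ times T, 0 < t →
    WaveOpDefinedAt n f x t ∧ WaveOpDefinedAt n (fun y => f y + g y) x t
  free_differentiable : ∀ x : E n, ∀ t ∈ times T,
    DifferentiableAt ℝ (fun τ => waveOp n f x τ) t
  duhamel_defined : ∀ x : E n, ∀ t ∈ times T, ∀ s : ℝ, 0 ≤ s → s < t →
    WaveOpDefinedAt n (fun y => nonlin n γ u y s / (1 + s) ^ 2) x (t - s)
  duhamel_integrable : ∀ x : E n, ∀ t ∈ times T,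
    IntervalIntegrable (duhamelIntegrand n (nonlin n γ u) x t) volume 0 t
  integral_equation : ∀ x : E n, ∀ t ∈ times T,
    u x t = ε * freeSol n f g x t + duhamel n (nonlin n γ u) x t

/-- There is one and only one solution on `ℝⁿ × [0,T)`. -/
def ExistsUniqueSolution (n : ℕ) (γ : ℝ) (f g : E n → ℝ) (ε : ℝ) (T : ENNReal) : Prop :=
  ∃ u : E n → ℝ → ℝ, IsSolution n γ f g ε T u ∧
    ∀ w : E n → ℝ → ℝ, IsSolution n γ f g ε T w → ∀ x : E n, ∀ t ∈ times T, w x t = u x t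

/-- The lifespan `T_ε`: the supremum of all `T ∈ (0,∞]` for which there is a unique solution on
`ℝⁿ × [0,T)` (it is `0` when there is no such `T`). -/
def lifespan (n : ℕ) (γ : ℝ) (f g : E n → ℝ) (ε : ℝ) : ENNReal :=
  sSup {T : ENNReal | 0 < T ∧ ExistsUniqueSolution n γ f g ε T}

end ConvWave

end

noncomputable section

/-! ### Polar coordinates and the law of one coordinate on the unit sphere. -/

namespace ConvWave
open Set Metric
open scoped ENNReal

/-! Everything happens on one annulus ρ ≤ |x| ≤ 4ρ during a time δρ. There the data exceed a ~
Aρ^{-1-ν}, so the free part gives u ≳ εat. If u ≥ M on the annulus, the convolution is ≳ ρ^{n-γ}M²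
and the weight (1+s)^{-2} is ≳ ρ^{-2}, so the Duhamel term gains ρ^{n-γ-2}M³ times the square of the
elapsed time. Starting from M ~ εaρ, the bound can be doubled over time steps that halve: the factor
4^{-k} lost in the squared step is exactly the factor 4^k gained in M². All doublings fit before the
time δρ as soon as ρ^{n-γ-2}(εaρ)²ρ² ~ ε²ρ^{n-γ-2ν} is large, and then `u` would be infinite at a
point where it is defined (`no_solution_of_large_annulus`). The critical ρ is the asserted bound
(`exists_lifespan_le`).

This requires W to be positive, which fails for general data in high dimensions but holds for radial
data far from the origin. With m = [n/2] and p = m-1, t^{2m-1} times the mean of a radial function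
is an integral over radii l against a time-independent density times ζ^p G(ζ), where ζ =
(t²-(r-l)²)/(4rl), G is smooth near 0 and G(0) > 0 (`exists_weightedMean_kernel`). Since ∂_t ζ =
2t/(4rl), each (1/t)∂_t lowers the power of ζ by one, and p of them leave a factor Q(ζ) with Q(0) >
0 (`radialDeriv_iterate_kernel`). For t ≤ δr the variable ζ is small where it is positive, so the
kernel is nonnegative; its mass is found by inserting the data 1. This yields
`exists_waveOp_lower_bound`.

The nonlinearity must be radial too. The equation commutes with linear isometries, so the uniqueness
built into the lifespan makes the solution radial (`radial_of_unique`). Uniqueness serves no other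
purpose. -/

/-- Polar coordinates for the Lebesgue integral of a nonnegative function. -/
lemma lintegral_polar {F : Type*} [NormedAddCommGroup F] [NormedSpace ℝ F] [MeasurableSpace F]
    [BorelSpace F] [FiniteDimensional ℝ F] [Nontrivial F] (μ : Measure F) [μ.IsAddHaarMeasure]
    {f : F → ℝ≥0∞} (hf : Measurable f) :
    ∫⁻ x, f x ∂μ = ∫⁻ ω : sphere (0 : F) 1, (∫⁻ r in Ioi (0 : ℝ),
      ENNReal.ofReal (r ^ (Module.finrank ℝ F - 1)) * f (r • (ω : F))) ∂μ.toSphere := by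
  have h1 : ∫⁻ x, f x ∂μ = ∫⁻ x : ({(0)}ᶜ : Set F), f x.1 ∂(μ.comap (↑)) := by
    rw [lintegral_subtype_comap (measurableSet_singleton _).compl, restrict_compl_singleton]
  have h2 := (μ.measurePreserving_homeomorphUnitSphereProd).lintegral_comp_emb
    (Homeomorph.measurableEmbedding _)
    (fun p : sphere (0 : F) 1 × Ioi (0 : ℝ) => f ((p.2 : ℝ) • (p.1 : F)))
  have h3 : ∀ x : ({(0)}ᶜ : Set F), f x.1 =
      f (((homeomorphUnitSphereProd F x).2 : ℝ) • ((homeomorphUnitSphereProd F x).1 : F)) := by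
    intro x
    have hx : (‖x.1‖ : ℝ) ≠ 0 := norm_ne_zero_iff.2 x.2
    simp [smul_smul, hx]
  have hm : Measurable (fun p : sphere (0 : F) 1 × Ioi (0 : ℝ) => f ((p.2 : ℝ) • (p.1 : F))) := by
    fun_prop
  rw [h1]
  simp_rw [h3]
  rw [h2, lintegral_prod _ hm.aemeasurable]
  refine lintegral_congr fun ω => ?_
  rw [Measure.volumeIoiPow, lintegral_withDensity_eq_lintegral_mul₀ (by fun_prop)
    (by fun_prop)]
  simp only [Pi.mul_apply]
  rw [lintegral_subtype_comap measurableSet_Ioi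
    (fun r : ℝ => ENNReal.ofReal (r ^ (Module.finrank ℝ F - 1)) * f (r • (ω : F)))]

/-- Polar coordinates for a nonnegative radial function. -/
lemma lintegral_fun_norm {F : Type*} [NormedAddCommGroup F] [NormedSpace ℝ F] [MeasurableSpace F]
    [BorelSpace F] [FiniteDimensional ℝ F] [Nontrivial F] (μ : Measure F) [μ.IsAddHaarMeasure]
    {f : ℝ → ℝ≥0∞} (hf : Measurable f) :
    ∫⁻ x, f ‖x‖ ∂μ = μ.toSphere univ * ∫⁻ r in Ioi (0 : ℝ),
      ENNReal.ofReal (r ^ (Module.finrank ℝ F - 1)) * f r := by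
  rw [lintegral_polar μ (f := fun x => f ‖x‖) (by fun_prop)]
  have : ∀ ω : sphere (0 : F) 1, ∫⁻ r in Ioi (0 : ℝ),
      ENNReal.ofReal (r ^ (Module.finrank ℝ F - 1)) * f ‖r • (ω : F)‖ = ∫⁻ r in Ioi (0 : ℝ),
      ENNReal.ofReal (r ^ (Module.finrank ℝ F - 1)) * f r := by
    intro ω
    refine setLIntegral_congr_fun measurableSet_Ioi fun r hr => ?_
    have hr' : (0 : ℝ) < r := hr
    simp [norm_smul, abs_of_pos hr']
  simp_rw [this]
  rw [lintegral_const, mul_comm]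

/-- Splitting off the first coordinate in `ℝ^{k+2}`. -/
lemma lintegral_first_coord_norm (k : ℕ) {Φ : ℝ × ℝ → ℝ≥0∞} (hΦ : Measurable Φ) :
    ∫⁻ y : E (k + 2), Φ (y 0, ‖y‖) =
      ∫⁻ z : ℝ, ∫⁻ y' : E (k + 1), Φ (z, √(z ^ 2 + ‖y'‖ ^ 2)) := by
  have e1 := (EuclideanSpace.volume_preserving_symm_measurableEquiv_toLp (Fin (k + 2))).symm
  have e2 := volume_preserving_piFinSuccAbove (fun _ : Fin (k + 2) => ℝ) 0
  have g1 := e1.lintegral_comp_emb (MeasurableEquiv.measurableEmbedding _)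
    (fun y : E (k + 2) => Φ (y 0, ‖y‖))
  have g2 := e2.lintegral_comp_emb (MeasurableEquiv.measurableEmbedding _)
    (fun p : ℝ × (Fin (k + 1) → ℝ) => Φ (p.1, √(p.1 ^ 2 + ‖(WithLp.toLp 2 p.2 : E (k + 1))‖ ^ 2)))
  have g3 : ∀ z : ℝ, _ := fun z =>
    (EuclideanSpace.volume_preserving_symm_measurableEquiv_toLp (Fin (k + 1))).symm.lintegral_comp_emb
    (MeasurableEquiv.measurableEmbedding _)
    (fun y' : E (k + 1) => Φ (z, √(z ^ 2 + ‖y'‖ ^ 2)))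
  rw [← g1]
  simp_rw [← g3]
  refine Eq.trans ?_ (Eq.trans g2 ?_)
  · refine lintegral_congr fun v => ?_
    congr 2
    have h0 : (0 : ℝ) ≤ ∑ i : Fin (k + 1), v i.succ ^ 2 := Finset.sum_nonneg fun _ _ => sq_nonneg _
    rw [EuclideanSpace.norm_eq, EuclideanSpace.norm_eq, Fin.sum_univ_succ]
    simp only [Real.norm_eq_abs, sq_abs]
    rw [Real.sq_sqrt (Finset.sum_nonneg fun _ _ => sq_nonneg _)]
    simp [MeasurableEquiv.piFinSuccAbove, Fin.tail, Fin.insertNthEquiv]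
  · exact lintegral_prod _ (by fun_prop)

/-- The law of one coordinate on the unit sphere of `ℝ^{k+2}`. -/
lemma lintegral_sphere_coord (k : ℕ) {f : ℝ → ℝ≥0∞} (hf : Measurable f) :
    ∫⁻ ω : sphere (0 : E (k + 2)) 1, f ((ω : E (k + 2)) 0) ∂(volume : Measure (E (k + 2))).toSphere =
      (volume : Measure (E (k + 1))).toSphere univ *
        ∫⁻ θ in Ioo 0 Real.pi, ENNReal.ofReal (Real.sin θ ^ k) * f (Real.cos θ) := by
  -- The radial factor of the unit ball of ℝ^{k+2}. It appears on both sides below and is cancelled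
  -- at the end, so it must be neither zero nor infinite.
  set D : ℝ≥0∞ := ∫⁻ r in Ioo (0 : ℝ) 1, ENNReal.ofReal (r ^ (k + 1)) with hD
  have hDval : D = ENNReal.ofReal (1 / (k + 2)) := by
    rw [hD, Measure.restrict_congr_set Ioo_ae_eq_Ioc,
      ← ofReal_integral_eq_lintegral_ofReal (intervalIntegral.intervalIntegrable_pow _).1
        (by filter_upwards [ae_restrict_mem measurableSet_Ioc] with y hy
            exact pow_nonneg hy.1.le _),
      ← intervalIntegral.integral_of_le zero_le_one]
    simp
    ring_nf
  have hD0 : D ≠ 0 := by rw [hDval]; simp; positivity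
  have hDt : D ≠ ∞ := by rw [hDval]; simp
  -- The test function f(y₀/|y|) on the unit ball is integrated in two ways: in polar coordinates of
  -- ℝ^{k+2}, and by slicing off y₀ and using polar coordinates in ℝ^{k+1}.
  set Φ : ℝ × ℝ → ℝ≥0∞ := fun p => (Iio (1 : ℝ)).indicator (fun _ => f (p.1 / p.2)) p.2 with hΦdef
  have hΦ : Measurable Φ := by
    have : Φ = (Prod.snd ⁻¹' Iio (1 : ℝ)).indicator (fun p => f (p.1 / p.2)) := by
      ext p; simp [hΦdef, indicator]
    rw [this]
    exact (by fun_prop : Measurable fun p : ℝ × ℝ => f (p.1 / p.2)).indicator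
      (measurable_snd measurableSet_Iio)
  have key := lintegral_first_coord_norm k hΦ
  have hL : ∫⁻ y : E (k + 2), Φ (y 0, ‖y‖) =
      (∫⁻ ω : sphere (0 : E (k + 2)) 1, f ((ω : E (k + 2)) 0)
        ∂(volume : Measure (E (k + 2))).toSphere) * D := by
    rw [lintegral_polar volume (f := fun y : E (k + 2) => Φ (y 0, ‖y‖)) (by fun_prop),
      ← lintegral_mul_const _ (by fun_prop)]
    refine lintegral_congr fun ω => ?_
    rw [hD, ← lintegral_const_mul _ (by fun_prop), ← lintegral_indicator measurableSet_Ioi,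
      ← lintegral_indicator measurableSet_Ioo]
    refine lintegral_congr fun r => ?_
    by_cases h0 : 0 < r
    · by_cases h1 : r < 1 <;>
        simp [hΦdef, indicator, h0, h1, norm_smul, abs_of_pos, mul_div_cancel_left₀, h0.ne', mul_comm]
    · simp [h0]
  have hR : ∫⁻ z : ℝ, ∫⁻ y' : E (k + 1), Φ (z, √(z ^ 2 + ‖y'‖ ^ 2)) =
      (volume : Measure (E (k + 1))).toSphere univ *
        (∫⁻ θ in Ioo 0 Real.pi, ENNReal.ofReal (Real.sin θ ^ k) * f (Real.cos θ)) * D := by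
    have h1 : ∀ z : ℝ, ∫⁻ y' : E (k + 1), Φ (z, √(z ^ 2 + ‖y'‖ ^ 2)) =
        (volume : Measure (E (k + 1))).toSphere univ * ∫⁻ r in Ioi (0 : ℝ),
          ENNReal.ofReal (r ^ k) * Φ (z, √(z ^ 2 + r ^ 2)) := by
      intro z
      rw [lintegral_fun_norm volume (f := fun r => Φ (z, √(z ^ 2 + r ^ 2))) (by fun_prop)]
      simp
    simp_rw [h1]
    rw [lintegral_const_mul', mul_assoc]
    swap
    · exact measure_ne_top _ _
    congr 1
    set Ψ : ℝ × ℝ → ℝ≥0∞ := fun p => (Ioi (0 : ℝ)).indicator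
      (fun r => ENNReal.ofReal (r ^ k) * Φ (p.1, √(p.1 ^ 2 + r ^ 2))) p.2 with hΨdef
    have hΨ : Measurable Ψ := by
      have : Ψ = (Prod.snd ⁻¹' Ioi (0 : ℝ)).indicator
          (fun p => ENNReal.ofReal (p.2 ^ k) * Φ (p.1, √(p.1 ^ 2 + p.2 ^ 2))) := by
        ext p; simp [hΨdef, indicator]
      rw [this]
      exact Measurable.indicator (by fun_prop) (measurable_snd measurableSet_Ioi)
    have h2 : ∫⁻ z : ℝ, ∫⁻ r in Ioi (0 : ℝ), ENNReal.ofReal (r ^ k) * Φ (z, √(z ^ 2 + r ^ 2)) =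
        ∫⁻ p, Ψ p := by
      rw [Measure.volume_eq_prod, lintegral_prod _ hΨ.aemeasurable]
      refine lintegral_congr fun z => ?_
      rw [← lintegral_indicator measurableSet_Ioi]
    -- Plane polar coordinates z = r cos θ, |y'| = r sin θ: the power |y'|^k and the Jacobian give
    -- r^{k+1} sin^k θ, so the r-integral is `D`. The angles with sin θ ≤ 0 contribute nothing.
    rw [h2, ← lintegral_comp_polarCoord_symm, polarCoord_target, Measure.volume_eq_prod,
      ← Measure.prod_restrict, lintegral_prod_symm]
    swap
    · refine Measurable.aemeasurable ?_
      simp only [polarCoord_symm_apply]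
      fun_prop
    rw [← lintegral_mul_const' _ _ hDt, ← lintegral_indicator measurableSet_Ioo,
      ← lintegral_indicator measurableSet_Ioo]
    refine lintegral_congr fun θ => ?_
    by_cases hθ : θ ∈ Ioo 0 Real.pi
    · have hθ' : θ ∈ Ioo (-Real.pi) Real.pi := ⟨by linarith [hθ.1, Real.pi_pos], hθ.2⟩
      rw [indicator_of_mem hθ, indicator_of_mem hθ', hD, ← lintegral_const_mul _ (by fun_prop),
        ← lintegral_indicator measurableSet_Ioi, ← lintegral_indicator measurableSet_Ioo]
      refine lintegral_congr fun r => ?_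
      have hs := Real.sin_pos_of_mem_Ioo hθ
      by_cases h0 : 0 < r
      · have hsq : √((r * Real.cos θ) ^ 2 + (r * Real.sin θ) ^ 2) = r := by
          rw [show (r * Real.cos θ) ^ 2 + (r * Real.sin θ) ^ 2 =
            r ^ 2 * (Real.sin θ ^ 2 + Real.cos θ ^ 2) by ring, Real.sin_sq_add_cos_sq, mul_one,
            Real.sqrt_sq h0.le]
        have hpos : 0 < r * Real.sin θ := mul_pos h0 hs
        by_cases h1 : r < 1
        · simp only [mem_Ioi, h0, indicator_of_mem, mem_Ioo, h1, and_self, polarCoord_symm_apply,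
            hΨdef, hpos, hsq, hΦdef, mem_Iio, smul_eq_mul, mul_div_cancel_left₀ _ h0.ne']
          rw [← mul_assoc, ← ENNReal.ofReal_mul h0.le, mul_right_comm,
            ← ENNReal.ofReal_mul (by positivity)]
          congr 2
          ring
        · simp [h0, h1, polarCoord_symm_apply, hΨdef, hpos, hsq, hΦdef]
      · simp [h0]
    · rw [indicator_of_notMem hθ]
      by_cases hθ' : θ ∈ Ioo (-Real.pi) Real.pi
      · rw [indicator_of_mem hθ', setLIntegral_congr_fun (g := fun _ => 0) measurableSet_Ioi]
        · simp
        intro r hr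
        have h0 : (0 : ℝ) < r := hr
        have hs : Real.sin θ ≤ 0 := by
          refine Real.sin_nonpos_of_nonpos_of_neg_pi_le ?_ hθ'.1.le
          by_contra h
          exact hθ ⟨not_le.1 h, hθ'.2⟩
        have : ¬ 0 < r * Real.sin θ := not_lt.2 (mul_nonpos_of_nonneg_of_nonpos h0.le hs)
        simp [polarCoord_symm_apply, hΨdef, this]
      · rw [indicator_of_notMem hθ']
  rw [hL, hR] at key
  exact (ENNReal.mul_left_inj hD0 hDt).1 key

end ConvWave

/-! ### The angular integrals behind the odd- and even-dimensional means. -/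

namespace ConvWave
open Set Metric
open scoped ENNReal

/-- A change of variables known for nonnegative functions holds for real-valued functions. -/
lemma integral_comp_mul_eq_of_lintegral {X : Type*} [MeasurableSpace X] {μ : Measure X}
    {ν : Measure ℝ} {N k : X → ℝ} {κ : ℝ → ℝ} (hN : Measurable N) (hk : Measurable k)
    (hκ : Measurable κ) (hk0 : ∀ x, 0 ≤ k x) (hκ0 : ∀ᵐ l ∂ν, 0 ≤ κ l)
    (h : ∀ f : ℝ → ℝ≥0∞, Measurable f →
      ∫⁻ x, f (N x) * ENNReal.ofReal (k x) ∂μ = ∫⁻ l, f l * ENNReal.ofReal (κ l) ∂ν)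
    {F : ℝ → ℝ} (hF : Measurable F) :
    ∫ x, F (N x) * k x ∂μ = ∫ l, F l * κ l ∂ν := by
  -- Tested on indicators, the hypothesis identifies two measures. Integrability of `F` is therefore
  -- not needed.
  have hmeas : (μ.withDensity fun x => ENNReal.ofReal (k x)).map N =
      ν.withDensity fun l => ENNReal.ofReal (κ l) := by
    ext s hs
    rw [Measure.map_apply hN hs, withDensity_apply _ (hN hs), withDensity_apply _ hs,
      ← lintegral_indicator (hN hs), ← lintegral_indicator hs]
    have := h (s.indicator 1) (measurable_one.indicator hs)
    convert this using 2
    · ext x; by_cases hx : N x ∈ s <;> simp [indicator, hx]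
    · ext l; by_cases hx : l ∈ s <;> simp [indicator, hx]
  have h1 : ∫ x, F (N x) * k x ∂μ = ∫ x, F (N x) ∂(μ.withDensity fun x => ENNReal.ofReal (k x)) := by
    simp only [ENNReal.ofReal]
    rw [integral_withDensity_eq_integral_smul hk.real_toNNReal]
    refine integral_congr_ae (.of_forall fun x => ?_)
    simp [NNReal.smul_def, Real.coe_toNNReal _ (hk0 x), mul_comm]
  have h2 : ∫ x, F x * κ x ∂ν = ∫ x, F x ∂(ν.withDensity fun x => ENNReal.ofReal (κ x)) := by
    simp only [ENNReal.ofReal]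
    rw [integral_withDensity_eq_integral_smul hκ.real_toNNReal]
    refine integral_congr_ae ?_
    filter_upwards [hκ0] with x hx
    simp [NNReal.smul_def, Real.coe_toNNReal _ hx, mul_comm]
  rw [h1, h2, ← hmeas, integral_map hN.aemeasurable hF.aestronglyMeasurable]

/-- The law of one coordinate on the unit sphere, with the density in terms of the coordinate. -/
lemma lintegral_sin_pow_cos (k : ℕ) (f : ℝ → ℝ≥0∞) :
    ∫⁻ θ in Ioo 0 Real.pi, ENNReal.ofReal (Real.sin θ ^ k) * f (Real.cos θ) =
      ∫⁻ c in Ioo (-1 : ℝ) 1, ENNReal.ofReal (√(1 - c ^ 2) ^ k / √(1 - c ^ 2)) * f c := by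
  have him : Real.arccos '' Ioo (-1 : ℝ) 1 = Ioo 0 Real.pi := by
    ext θ
    constructor
    · rintro ⟨c, hc, rfl⟩
      exact ⟨Real.arccos_pos.2 hc.2, Real.arccos_lt_pi.2 hc.1⟩
    · intro hθ
      refine ⟨Real.cos θ, ⟨?_, ?_⟩, Real.arccos_cos hθ.1.le hθ.2.le⟩
      · rw [← Real.cos_pi]
        exact Real.cos_lt_cos_of_nonneg_of_le_pi hθ.1.le le_rfl hθ.2
      · rw [← Real.cos_zero]
        exact Real.cos_lt_cos_of_nonneg_of_le_pi le_rfl hθ.2.le hθ.1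
  rw [← him, lintegral_image_eq_lintegral_abs_deriv_mul (f' := fun c => -(1 / √(1 - c ^ 2)))
    measurableSet_Ioo
    (fun c hc => (Real.hasDerivAt_arccos hc.1.ne' hc.2.ne).hasDerivWithinAt)
    (Real.arccos_injOn.mono Ioo_subset_Icc_self)]
  refine setLIntegral_congr_fun measurableSet_Ioo fun c hc => ?_
  simp only [Real.sin_arccos, Real.cos_arccos hc.1.le hc.2.le, abs_neg]
  rw [← mul_assoc, ← ENNReal.ofReal_mul (abs_nonneg _), abs_of_nonneg (by positivity)]
  congr 2
  ring

/-- The unit vector of the first coordinate axis. -/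
def axis (k : ℕ) : E (k + 1) := EuclideanSpace.single 0 1

lemma norm_axis (k : ℕ) : ‖axis k‖ = 1 := by simp [axis]

lemma inner_axis (k : ℕ) (y : E (k + 1)) : inner ℝ (axis k) y = y 0 := by
  simp [axis, EuclideanSpace.inner_single_left]

lemma norm_axis_add_sq (k : ℕ) (r t : ℝ) (y : E (k + 1)) :
    ‖r • axis k + t • y‖ ^ 2 = r ^ 2 + 2 * r * t * y 0 + t ^ 2 * ‖y‖ ^ 2 := by
  rw [norm_add_sq_real, norm_smul, norm_smul, norm_axis, inner_smul_left, inner_smul_right,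
    inner_axis, mul_pow, mul_pow]
  simp
  ring

/-- A coordinate c of a point of the sphere in dimension 2p+3 has density proportional to (1-c²)^p;
substitute l² = r² + 2rtc + t², so that dc = l/(rt) dl. -/
lemma lintegral_sphere_norm_odd (p : ℕ) {r t : ℝ} (ht : 0 < t) (htr : t < r) {f : ℝ → ℝ≥0∞}
    (hf : Measurable f) :
    ∫⁻ ω : sphere (0 : E (2 * p + 3)) 1, f ‖r • axis _ + t • (ω : E (2 * p + 3))‖
        ∂(volume : Measure (E (2 * p + 3))).toSphere =
      (volume : Measure (E (2 * p + 2))).toSphere univ * ∫⁻ l in Ioo (r - t) (r + t),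
        f l * ENNReal.ofReal ((1 - ((l ^ 2 - r ^ 2 - t ^ 2) / (2 * r * t)) ^ 2) ^ p * l / (r * t)) := by
  have hr : 0 < r := ht.trans htr
  have h1 : ∀ ω : sphere (0 : E (2 * p + 3)) 1, f ‖r • axis _ + t • (ω : E (2 * p + 3))‖ =
      f √(r ^ 2 + 2 * r * t * (ω : E (2 * p + 3)) 0 + t ^ 2) := by
    intro ω
    rw [← Real.sqrt_sq (norm_nonneg (r • axis _ + t • (ω : E (2 * p + 3)))), norm_axis_add_sq]
    simp
  simp_rw [h1]
  rw [lintegral_sphere_coord (2 * p + 1) (f := fun c => f √(r ^ 2 + 2 * r * t * c + t ^ 2))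
    (by fun_prop), lintegral_sin_pow_cos (2 * p + 1) (fun c => f √(r ^ 2 + 2 * r * t * c + t ^ 2))]
  congr 1
  have him : (fun l => (l ^ 2 - r ^ 2 - t ^ 2) / (2 * r * t)) '' Ioo (r - t) (r + t) =
      Ioo (-1 : ℝ) 1 := by
    ext c
    have h2 : 0 < 2 * r * t := by positivity
    constructor
    · rintro ⟨l, ⟨hl1, hl2⟩, rfl⟩
      constructor
      · rw [lt_div_iff₀ h2]; nlinarith
      · rw [div_lt_iff₀ h2]; nlinarith
    · rintro ⟨hc1, hc2⟩
      have h3 : (r - t) ^ 2 < r ^ 2 + 2 * r * t * c + t ^ 2 := by nlinarith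
      have h4 : r ^ 2 + 2 * r * t * c + t ^ 2 < (r + t) ^ 2 := by nlinarith
      refine ⟨√(r ^ 2 + 2 * r * t * c + t ^ 2), ⟨Real.lt_sqrt_of_sq_lt h3, ?_⟩, ?_⟩
      · exact (Real.sqrt_lt' (by positivity)).2 h4
      · dsimp only
        rw [Real.sq_sqrt ((sq_nonneg _).trans h3.le)]
        field_simp
        ring
  rw [← him, lintegral_image_eq_lintegral_abs_deriv_mul
    (f' := fun l => 2 * l / (2 * r * t)) measurableSet_Ioo]
  rotate_left
  · intro l _
    have := (((hasDerivAt_pow 2 l).sub_const (r ^ 2)).sub_const (t ^ 2)).div_const (2 * r * t)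
    simpa using this.hasDerivWithinAt
  · intro a ha b hb hab
    dsimp only at hab
    have : a ^ 2 = b ^ 2 := by
      field_simp at hab
      linarith
    have ha0 : 0 ≤ a := by linarith [ha.1]
    have hb0 : 0 ≤ b := by linarith [hb.1]
    exact (pow_left_inj₀ ha0 hb0 two_ne_zero).1 this
  refine setLIntegral_congr_fun measurableSet_Ioo fun l hl => ?_
  have hl0 : 0 < l := by linarith [hl.1]
  have hc : (l ^ 2 - r ^ 2 - t ^ 2) / (2 * r * t) ∈ Ioo (-1 : ℝ) 1 := him ▸ mem_image_of_mem _ hl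
  set c := (l ^ 2 - r ^ 2 - t ^ 2) / (2 * r * t) with hcdef
  have hc2 : 0 < 1 - c ^ 2 := by nlinarith [hc.1, hc.2]
  have hl2 : r ^ 2 + 2 * r * t * c + t ^ 2 = l ^ 2 := by rw [hcdef]; field_simp; ring
  rw [hl2, Real.sqrt_sq hl0.le, abs_of_pos (by positivity), ← mul_assoc,
    ← ENNReal.ofReal_mul (by positivity), mul_comm]
  congr 2
  have hs : √(1 - c ^ 2) ≠ 0 := (Real.sqrt_pos.2 hc2).ne'
  rw [pow_succ, pow_mul, Real.sq_sqrt hc2.le]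
  field_simp

/-- The singular weight `σ^p / √(σ(1-σ))` on `(0,1)`. -/
def arcsineWeight (p : ℕ) (σ : ℝ) : ℝ := σ ^ p / (√σ * √(1 - σ))

lemma measurable_arcsineWeight (p : ℕ) : Measurable (arcsineWeight p) := by
  unfold arcsineWeight; fun_prop

lemma arcsineWeight_pos (p : ℕ) {σ : ℝ} (hσ : σ ∈ Ioo (0 : ℝ) 1) : 0 < arcsineWeight p σ := by
  have h1 := hσ.1
  have h2 := sub_pos.2 hσ.2
  unfold arcsineWeight
  positivity

lemma integrableOn_arcsineWeight (p : ℕ) : IntegrableOn (arcsineWeight p) (Ioo 0 1) := by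
  have h0 : IntegrableOn (fun σ : ℝ => 1 / (√σ * √(1 - σ))) (Ioo 0 1) := by
    refine IntegrableOn.mono_set (t := Ioc 0 1) ?_ Ioo_subset_Ioc_self
    -- The function arcsin(2σ-1) is a continuous primitive of 1/√(σ(1-σ)); continuity up to the
    -- endpoints gives integrability.
    refine intervalIntegral.integrableOn_deriv_of_nonneg
      (g := fun σ => Real.arcsin (2 * σ - 1)) (by fun_prop) (fun σ hσ => ?_) (fun σ _ => by positivity)
    have h1 : HasDerivAt (fun σ : ℝ => 2 * σ - 1) 2 σ := by
      simpa using ((hasDerivAt_id σ).const_mul 2).sub_const 1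
    have h2 := (Real.hasDerivAt_arcsin (x := 2 * σ - 1) (by linarith [hσ.1])
      (by linarith [hσ.2])).comp σ h1
    refine h2.congr_deriv ?_
    rw [← Real.sqrt_mul hσ.1.le, show 1 - (2 * σ - 1) ^ 2 = 2 ^ 2 * (σ * (1 - σ)) by ring,
      Real.sqrt_mul (by norm_num), Real.sqrt_sq (by norm_num)]
    have : √(σ * (1 - σ)) ≠ 0 := (Real.sqrt_pos.2 (mul_pos hσ.1 (sub_pos.2 hσ.2))).ne'
    field_simp
  refine Integrable.mono' h0 (measurable_arcsineWeight p).aestronglyMeasurable ?_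
  filter_upwards [ae_restrict_mem measurableSet_Ioo] with σ hσ
  rw [Real.norm_of_nonneg (arcsineWeight_pos p hσ).le]
  have := pow_le_one₀ (n := p) hσ.1.le hσ.2.le
  unfold arcsineWeight
  gcongr

/-- The analytic factor of the even-dimensional kernel. -/
def kernelEven (p : ℕ) (ζ : ℝ) : ℝ :=
  ∫ σ in Ioo (0 : ℝ) 1, arcsineWeight p σ * ((1 - ζ * σ) ^ p / √(1 - ζ * σ))

lemma integrableOn_kernelEven (p : ℕ) {ζ : ℝ} (h0 : 0 ≤ ζ) (h1 : ζ < 1) :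
    IntegrableOn (fun σ => arcsineWeight p σ * ((1 - ζ * σ) ^ p / √(1 - ζ * σ))) (Ioo 0 1) := by
  refine Integrable.mono' ((integrableOn_arcsineWeight p).mul_const (1 / √(1 - ζ)))
    ((measurable_arcsineWeight p).mul (by fun_prop)).aestronglyMeasurable ?_
  filter_upwards [ae_restrict_mem measurableSet_Ioo] with σ hσ
  have h2 : ζ * σ ≤ ζ := mul_le_of_le_one_right h0 hσ.2.le
  have h3 : 0 ≤ ζ * σ := mul_nonneg h0 hσ.1.le
  have hw := arcsineWeight_pos p hσ
  have h4 : 0 ≤ 1 - ζ * σ := by linarith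
  have h5 : 0 < 1 - ζ := by linarith
  rw [Real.norm_of_nonneg (by positivity)]
  gcongr
  exact pow_le_one₀ h4 (by linarith)

/-- The substitution c = 1-2ζσ gives 1-c² = 4ζσ(1-ζσ) and bζ - b(1-c)/2 = bζ(1-σ). The half powers
of ζ cancel, which leaves ζ^p times a function that is smooth at ζ = 0. -/
lemma lintegral_kernelEven (p : ℕ) {ζ b : ℝ} (h0 : 0 < ζ) (h1 : ζ < 1) (hb : 0 < b) :
    ∫⁻ c in Ioo (-1 : ℝ) 1, ENNReal.ofReal (√(1 - c ^ 2) ^ (2 * p) / √(1 - c ^ 2)) *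
      ENNReal.ofReal (1 / √(b * ζ - b / 2 * (1 - c))) =
    ENNReal.ofReal (4 ^ p * ζ ^ p * kernelEven p ζ / √b) := by
  have him : (fun σ => 1 - 2 * ζ * σ) '' Ioo (0 : ℝ) 1 = Ioo (1 - 2 * ζ) 1 := by
    ext c
    constructor
    · rintro ⟨σ, hσ, rfl⟩
      constructor <;> dsimp only <;> nlinarith [hσ.1, hσ.2]
    · rintro ⟨hc1, hc2⟩
      refine ⟨(1 - c) / (2 * ζ), ⟨by apply div_pos <;> linarith, ?_⟩, ?_⟩
      · rw [div_lt_one (by positivity)]; linarith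
      · dsimp only; field_simp; ring
  have hsub : Ioo (1 - 2 * ζ) 1 ⊆ Ioo (-1 : ℝ) 1 := Ioo_subset_Ioo_left (by linarith)
  rw [← lintegral_indicator measurableSet_Ioo]
  -- For c ≤ 1-2ζ the radicand is nonpositive, so the conventions for `√` and division by zero make
  -- the integrand vanish.
  have hres : ∀ c : ℝ, (Ioo (-1 : ℝ) 1).indicator (fun c =>
      ENNReal.ofReal (√(1 - c ^ 2) ^ (2 * p) / √(1 - c ^ 2)) *
        ENNReal.ofReal (1 / √(b * ζ - b / 2 * (1 - c)))) c =
      (Ioo (1 - 2 * ζ) 1).indicator (fun c =>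
      ENNReal.ofReal (√(1 - c ^ 2) ^ (2 * p) / √(1 - c ^ 2)) *
        ENNReal.ofReal (1 / √(b * ζ - b / 2 * (1 - c)))) c := by
    intro c
    by_cases hc : c ∈ Ioo (1 - 2 * ζ) 1
    · rw [indicator_of_mem hc, indicator_of_mem (hsub hc)]
    · rw [indicator_of_notMem hc]
      by_cases hc' : c ∈ Ioo (-1 : ℝ) 1
      · rw [indicator_of_mem hc']
        have : b * ζ - b / 2 * (1 - c) ≤ 0 := by
          have : c ≤ 1 - 2 * ζ := by
            by_contra h
            exact hc ⟨not_le.1 h, hc'.2⟩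
          nlinarith
        rw [Real.sqrt_eq_zero_of_nonpos this]
        simp
      · rw [indicator_of_notMem hc']
  simp_rw [hres]
  rw [lintegral_indicator measurableSet_Ioo, ← him,
    lintegral_image_eq_lintegral_abs_deriv_mul (f' := fun _ => -(2 * ζ)) measurableSet_Ioo]
  rotate_left
  · intro σ _
    have := ((hasDerivAt_id σ).const_mul (2 * ζ)).const_sub 1
    simpa using this.hasDerivWithinAt
  · intro a _ c _ hac
    dsimp only at hac
    have : (2 * ζ) * (a - c) = 0 := by linarith
    rcases mul_eq_zero.1 this with h | h <;> linarith
  have hint : 4 ^ p * ζ ^ p * kernelEven p ζ / √b = ∫ σ in Ioo (0 : ℝ) 1,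
      (4 ^ p * ζ ^ p / √b) * (arcsineWeight p σ * ((1 - ζ * σ) ^ p / √(1 - ζ * σ))) := by
    rw [integral_const_mul, kernelEven]
    ring
  have hpos : ∀ σ ∈ Ioo (0 : ℝ) 1, 0 < 1 - ζ * σ := fun σ hσ => by nlinarith [hσ.1, hσ.2]
  rw [hint, ofReal_integral_eq_lintegral_ofReal ((integrableOn_kernelEven p h0.le h1).const_mul _)]
  rotate_left
  · filter_upwards [ae_restrict_mem measurableSet_Ioo] with σ hσ
    have := (arcsineWeight_pos p hσ).le
    have := (hpos σ hσ).le
    show (0 : ℝ) ≤ _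
    positivity
  refine setLIntegral_congr_fun measurableSet_Ioo fun σ hσ => ?_
  have hσ0 := hσ.1
  have hσ1 : 0 < 1 - σ := sub_pos.2 hσ.2
  have h2 := hpos σ hσ
  rw [← ENNReal.ofReal_mul (by positivity), ← ENNReal.ofReal_mul (by positivity)]
  congr 1
  have e1 : 1 - (1 - 2 * ζ * σ) ^ 2 = 2 ^ 2 * (ζ * (σ * (1 - ζ * σ))) := by ring
  have e2 : b * ζ - b / 2 * (1 - (1 - 2 * ζ * σ)) = b * (ζ * (1 - σ)) := by ring
  rw [e1, e2, pow_mul, Real.sq_sqrt (by positivity), Real.sqrt_mul (by norm_num),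
    Real.sqrt_sq (by norm_num), Real.sqrt_mul h0.le, Real.sqrt_mul hσ0.le, Real.sqrt_mul hb.le,
    Real.sqrt_mul h0.le, abs_neg, abs_of_pos (by positivity), arcsineWeight]
  have s1 : √ζ ≠ 0 := (Real.sqrt_pos.2 h0).ne'
  have s2 : √σ ≠ 0 := (Real.sqrt_pos.2 hσ0).ne'
  have s3 : √(1 - σ) ≠ 0 := (Real.sqrt_pos.2 hσ1).ne'
  have s4 : √(1 - ζ * σ) ≠ 0 := (Real.sqrt_pos.2 h2).ne'
  have s5 : √b ≠ 0 := (Real.sqrt_pos.2 hb).ne'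
  have s6 : √ζ ^ 2 = ζ := Real.sq_sqrt h0.le
  rw [mul_pow, mul_pow, mul_pow, ← pow_mul]
  field_simp
  rw [s6, pow_mul]
  ring

end ConvWave

/-! ### Means of radial functions in terms of the similarity variable. -/

namespace ConvWave
open Set Metric
open scoped ENNReal

/-- The kernel `ζ^p G(ζ)`, cut off at `ζ ≤ 0`. -/
def truncKernel (p : ℕ) (G : ℝ → ℝ) (ζ : ℝ) : ℝ := if 0 < ζ then ζ ^ p * G ζ else 0

/-- The similarity variable `(t² - (r - l)²) / (4 r l)`. -/
def simVar (r t l : ℝ) : ℝ := (t ^ 2 - (r - l) ^ 2) / (4 * r * l)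

lemma measurable_truncKernel (p : ℕ) {G : ℝ → ℝ} (hG : Measurable G) :
    Measurable (truncKernel p G) :=
  Measurable.ite measurableSet_Ioi (by fun_prop) measurable_const

lemma measurable_simVar (r t : ℝ) : Measurable (simVar r t) := by
  unfold simVar; fun_prop

lemma simVar_lt_one {r t l : ℝ} (ht : 0 < t) (htr : t < r) (hl : 0 < l) : simVar r t l < 1 := by
  have hr : 0 < r := ht.trans htr
  rw [simVar, div_lt_one (by positivity)]
  nlinarith

lemma simVar_pos_iff {r t l : ℝ} (ht : 0 < t) (hr : 0 < r) (hl : 0 < l) :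
    0 < simVar r t l ↔ l ∈ Ioo (r - t) (r + t) := by
  rw [simVar, div_pos_iff_of_pos_right (by positivity), sub_pos, sq_lt_sq, abs_of_pos ht, abs_lt, mem_Ioo]
  constructor <;> rintro ⟨h1, h2⟩ <;> constructor <;> linarith

lemma measurable_kernelEven (p : ℕ) : Measurable (kernelEven p) := by
  unfold kernelEven
  refine StronglyMeasurable.measurable ?_
  refine StronglyMeasurable.integral_prod_right (f := fun ζ σ =>
    arcsineWeight p σ * ((1 - ζ * σ) ^ p / √(1 - ζ * σ))) ?_
  refine Measurable.stronglyMeasurable ?_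
  have := measurable_arcsineWeight p
  fun_prop

/-- The area of the unit sphere of `ℝ^{k+1}`, as a real number. -/
def sphereMass (k : ℕ) : ℝ := ((volume : Measure (E (k + 1))).toSphere univ).toReal

lemma sphereMass_pos (k : ℕ) : 0 < sphereMass k :=
  ENNReal.toReal_pos (Measure.measure_univ_ne_zero.2 (Measure.toSphere_ne_zero _)) (measure_ne_top _ _)

lemma ofReal_sphereMass (k : ℕ) :
    ENNReal.ofReal (sphereMass k) = (volume : Measure (E (k + 1))).toSphere univ :=
  ENNReal.ofReal_toReal (measure_ne_top _ _)

/-- On the sphere of radius l about the origin, t² - |y - re|² = 4rl(ζ - (1-c)/2), where c is the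
first coordinate of y/l. The angular integral is thus `lintegral_kernelEven` with b = 4rl, and it is
zero if ζ ≤ 0. -/
lemma lintegral_norm_even (p : ℕ) {r t : ℝ} (ht : 0 < t) (htr : t < r) {f : ℝ → ℝ≥0∞}
    (hf : Measurable f) :
    ∫⁻ y : E (2 * p + 2), f ‖y‖ * ENNReal.ofReal (1 / √(t ^ 2 - ‖y - r • axis _‖ ^ 2)) =
      ∫⁻ l in Ioi (0 : ℝ), f l * ENNReal.ofReal (sphereMass (2 * p) * l ^ (2 * p + 1) * 4 ^ p /
        √(4 * r * l) * truncKernel p (kernelEven p) (simVar r t l)) := by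
  have hr : 0 < r := ht.trans htr
  rw [lintegral_polar volume (by fun_prop)]
  have h1 : ∀ ω : sphere (0 : E (2 * p + 2)) 1, (∫⁻ l in Ioi (0 : ℝ),
      ENNReal.ofReal (l ^ (Module.finrank ℝ (E (2 * p + 2)) - 1)) *
        (f ‖l • (ω : E (2 * p + 2))‖ *
          ENNReal.ofReal (1 / √(t ^ 2 - ‖l • (ω : E (2 * p + 2)) - r • axis _‖ ^ 2)))) =
      ∫⁻ l in Ioi (0 : ℝ), ENNReal.ofReal (l ^ (2 * p + 1)) * (f l *
        ENNReal.ofReal (1 / √(t ^ 2 - (l ^ 2 + r ^ 2 - 2 * r * l * (ω : E (2 * p + 2)) 0)))) := by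
    intro ω
    refine setLIntegral_congr_fun measurableSet_Ioi fun l hl => ?_
    have hl0 : (0 : ℝ) < l := hl
    have h2 : ‖l • (ω : E (2 * p + 2)) - r • axis _‖ ^ 2 =
        l ^ 2 + r ^ 2 - 2 * r * l * (ω : E (2 * p + 2)) 0 := by
      have := norm_axis_add_sq (2 * p + 1) (-r) l ω
      rw [show l • (ω : E (2 * p + 2)) - r • axis _ = -r • axis _ + l • (ω : E (2 * p + 2)) by
        rw [neg_smul]; abel, this]
      simp
      ring
    simp only [h2]
    simp [norm_smul, abs_of_pos hl0]
  simp_rw [h1]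
  rw [lintegral_lintegral_swap (by fun_prop)]
  refine setLIntegral_congr_fun measurableSet_Ioi fun l hl => ?_
  have hl0 : (0 : ℝ) < l := hl
  rw [lintegral_const_mul _ (by fun_prop), lintegral_const_mul _ (by fun_prop),
    lintegral_sphere_coord (2 * p) (f := fun c => ENNReal.ofReal (1 / √(t ^ 2 -
      (l ^ 2 + r ^ 2 - 2 * r * l * c)))) (by fun_prop),
    lintegral_sin_pow_cos (2 * p) (fun c => ENNReal.ofReal (1 / √(t ^ 2 -
      (l ^ 2 + r ^ 2 - 2 * r * l * c)))), ← ofReal_sphereMass]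
  have hm := sphereMass_pos (2 * p)
  have hb : 0 < 4 * r * l := by positivity
  by_cases hζ : 0 < simVar r t l
  · have h3 : ∀ c, t ^ 2 - (l ^ 2 + r ^ 2 - 2 * r * l * c) =
        4 * r * l * simVar r t l - 4 * r * l / 2 * (1 - c) := by
      intro c
      rw [simVar]
      field_simp
      ring
    simp_rw [h3]
    rw [lintegral_kernelEven p hζ (simVar_lt_one ht htr hl0) hb, truncKernel, if_pos hζ,
      ← ENNReal.ofReal_mul hm.le, mul_left_comm, ← ENNReal.ofReal_mul (by positivity)]
    congr 2
    ring
  · rw [truncKernel, if_neg hζ, mul_zero, ENNReal.ofReal_zero, mul_zero]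
    have : ∫⁻ c in Ioo (-1 : ℝ) 1, ENNReal.ofReal (√(1 - c ^ 2) ^ (2 * p) / √(1 - c ^ 2)) *
        ENNReal.ofReal (1 / √(t ^ 2 - (l ^ 2 + r ^ 2 - 2 * r * l * c))) = 0 := by
      rw [setLIntegral_congr_fun (g := fun _ => 0) measurableSet_Ioo]
      · simp
      intro c hc
      have hw : t ^ 2 - (r - l) ^ 2 ≤ 0 := by
        rw [simVar, div_pos_iff_of_pos_right hb] at hζ
        exact not_lt.1 hζ
      have : t ^ 2 - (l ^ 2 + r ^ 2 - 2 * r * l * c) ≤ 0 := by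
        nlinarith [hc.2, mul_pos hr hl0]
      dsimp only
      rw [Real.sqrt_eq_zero_of_nonpos this]
      simp
    rw [this]
    simp

/-- The mean in even dimensions as an integral over the whole space. -/
lemma weightedMean_even (p : ℕ) (φ : E (2 * p + 2) → ℝ) (x : E (2 * p + 2)) {t : ℝ} (ht : 0 < t) :
    weightedMean (2 * p + 2) φ x t =
      2 / sphereArea (2 * p + 3) * ∫ y, φ y * (1 / √(t ^ 2 - ‖y - x‖ ^ 2)) := by
  -- Outside the ball the root is 0, and so is the quotient: the domain restriction is automatic.
  have h1 : ∫ ξ in closedBall (0 : E (2 * p + 2)) 1, φ (x + t • ξ) / √(1 - ‖ξ‖ ^ 2) =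
      ∫ ξ : E (2 * p + 2), φ (x + t • ξ) / √(1 - ‖ξ‖ ^ 2) := by
    refine setIntegral_eq_integral_of_forall_compl_eq_zero fun ξ hξ => ?_
    have : 1 < ‖ξ‖ := by simpa using hξ
    rw [Real.sqrt_eq_zero_of_nonpos (by nlinarith)]
    simp
  have h2 : ∀ ξ : E (2 * p + 2), φ (x + t • ξ) / √(1 - ‖ξ‖ ^ 2) =
      t * (fun η : E (2 * p + 2) => φ (x + η) * (1 / √(t ^ 2 - ‖(x + η) - x‖ ^ 2))) (t • ξ) := by
    intro ξ
    have : t ^ 2 - ‖(x + t • ξ) - x‖ ^ 2 = t ^ 2 * (1 - ‖ξ‖ ^ 2) := by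
      rw [add_sub_cancel_left, norm_smul, Real.norm_of_nonneg ht.le]; ring
    simp only [this]
    rw [Real.sqrt_mul (by positivity), Real.sqrt_sq ht.le]
    field_simp
  have hodd : ¬ Odd (2 * p + 2) := by rw [Nat.not_odd_iff_even]; exact ⟨p + 1, by ring⟩
  rw [weightedMean, mean, if_neg hodd, h1]
  simp_rw [h2]
  rw [integral_const_mul, Measure.integral_comp_smul volume
      (fun η : E (2 * p + 2) => φ (x + η) * (1 / √(t ^ 2 - ‖(x + η) - x‖ ^ 2))) t,
    integral_add_left_eq_self (fun y => φ y * (1 / √(t ^ 2 - ‖y - x‖ ^ 2)))]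
  have h3 : 2 * ((2 * p + 2) / 2) - 1 = 2 * p + 1 := by omega
  rw [h3, finrank_euclideanSpace_fin, abs_of_pos (by positivity), smul_eq_mul]
  field_simp
  ring

lemma sphereArea_pos (k : ℕ) : 0 < sphereArea (k + 1) := by
  have := Real.Gamma_pos_of_pos (s := ((k + 1 : ℕ) : ℝ) / 2) (by positivity)
  have := Real.pi_pos
  unfold sphereArea
  positivity

lemma truncKernel_simVar_nonpos {p : ℕ} {G : ℝ → ℝ} {r t l : ℝ} (ht : 0 < t) (hr : 0 < r)
    (hl : 0 < l) (h : l ∉ Ioo (r - t) (r + t)) : truncKernel p G (simVar r t l) = 0 := by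
  rw [truncKernel, if_neg]
  rwa [simVar_pos_iff ht hr hl]

/-- A function is radial. -/
def Radial {n : ℕ} (φ : E n → ℝ) : Prop := ∀ x y : E n, ‖x‖ = ‖y‖ → φ x = φ y

lemma Radial.eq_axis {k : ℕ} {φ : E (k + 1) → ℝ} (h : Radial φ) (x : E (k + 1)) :
    φ x = φ (‖x‖ • axis k) :=
  h _ _ (by simp [norm_smul, norm_axis])

/-- The factor of the even-dimensional kernel that does not depend on time. -/
def densityEven (p : ℕ) (r l : ℝ) : ℝ :=
  2 / sphereArea (2 * p + 3) * (sphereMass (2 * p) * l ^ (2 * p + 1) * 4 ^ p / √(4 * r * l))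

/-- The factor of the odd-dimensional kernel that does not depend on time. -/
def densityOdd (p : ℕ) (r l : ℝ) : ℝ :=
  1 / sphereArea (2 * p + 3) *
    (sphereMass (2 * p + 1) * (4 * r * l) ^ (2 * p) * l / (4 ^ p * r ^ (2 * p + 1)))

lemma densityEven_pos (p : ℕ) {r l : ℝ} (hr : 0 < r) (hl : 0 < l) : 0 < densityEven p r l := by
  have := sphereArea_pos (2 * p + 2)
  have := sphereMass_pos (2 * p)
  unfold densityEven
  positivity

lemma densityOdd_pos (p : ℕ) {r l : ℝ} (hr : 0 < r) (hl : 0 < l) : 0 < densityOdd p r l := by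
  have := sphereArea_pos (2 * p + 2)
  have := sphereMass_pos (2 * p + 1)
  unfold densityOdd
  positivity

lemma continuousOn_densityEven (p : ℕ) {r : ℝ} (hr : 0 < r) :
    ContinuousOn (densityEven p r) (Ioi 0) := by
  unfold densityEven
  refine continuousOn_const.mul (ContinuousOn.div (by fun_prop) (by fun_prop) fun l hl => ?_)
  have : (0 : ℝ) < l := hl
  positivity

lemma continuous_densityOdd (p : ℕ) (r : ℝ) : Continuous (densityOdd p r) := by
  unfold densityOdd; fun_prop

lemma kernelEven_nonneg (p : ℕ) {ζ : ℝ} (h0 : 0 ≤ ζ) (h1 : ζ < 1) : 0 ≤ kernelEven p ζ := by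
  refine setIntegral_nonneg measurableSet_Ioo fun σ hσ => ?_
  have := (arcsineWeight_pos p hσ).le
  have : 0 ≤ 1 - ζ * σ := by nlinarith [hσ.1, hσ.2]
  positivity

/-- The interval of integration is tied to `t₁` and not to `t`, at no cost because the truncated
kernel vanishes for |l-r| ≥ t. Time then enters through ζ alone, ready for differentiation under the
integral. -/
lemma weightedMean_even_axis (p : ℕ) {φ : E (2 * p + 2) → ℝ} (hφ : Continuous φ) (hrad : Radial φ)
    {r t t₁ : ℝ} (ht : 0 < t) (htt : t < t₁) (htr : t₁ ≤ r) :
    weightedMean (2 * p + 2) φ (r • axis _) t =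
      ∫ l in Ioo (r - t₁) (r + t₁), φ (l • axis _) * densityEven p r l *
        truncKernel p (kernelEven p) (simVar r t l) := by
  have hr : 0 < r := by linarith
  rw [weightedMean_even p φ _ ht]
  have h1 := integral_comp_mul_eq_of_lintegral (μ := volume) (ν := volume.restrict (Ioi (0 : ℝ)))
    (N := fun y : E (2 * p + 2) => ‖y‖)
    (k := fun y : E (2 * p + 2) => 1 / √(t ^ 2 - ‖y - r • axis _‖ ^ 2))
    (κ := fun l => sphereMass (2 * p) * l ^ (2 * p + 1) * 4 ^ p /
        √(4 * r * l) * truncKernel p (kernelEven p) (simVar r t l))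
    (by fun_prop) (by fun_prop)
    ((by fun_prop : Measurable fun l : ℝ => sphereMass (2 * p) * l ^ (2 * p + 1) * 4 ^ p /
        √(4 * r * l)).mul
      ((measurable_truncKernel p (measurable_kernelEven p)).comp (measurable_simVar r t)))
    (fun _ => by positivity) ?_ (fun f hf => lintegral_norm_even p ht (htt.trans_le htr) hf)
    (F := fun l => φ (l • axis _)) (by fun_prop)
  · simp_rw [← hrad.eq_axis] at h1
    rw [h1, ← integral_const_mul, setIntegral_eq_of_subset_of_forall_sdiff_eq_zero
      measurableSet_Ioi (s := Ioo (r - t₁) (r + t₁))]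
    · refine integral_congr_ae (.of_forall fun l => ?_)
      simp only [densityEven]
      ring
    · intro l hl
      have := hl.1
      simp only [mem_Ioi]
      linarith
    · intro l hl
      rw [truncKernel_simVar_nonpos ht hr hl.1 fun h =>
        hl.2 ⟨by linarith [h.1], by linarith [h.2]⟩]
      simp
  · filter_upwards [ae_restrict_mem measurableSet_Ioi] with l hl
    have hl0 : (0 : ℝ) < l := hl
    have := (sphereMass_pos (2 * p)).le
    have : 0 ≤ truncKernel p (kernelEven p) (simVar r t l) := by
      unfold truncKernel
      split_ifs with h
      · have := kernelEven_nonneg p h.le (simVar_lt_one ht (htt.trans_le htr) hl0)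
        positivity
      · exact le_rfl
    show (0 : ℝ) ≤ _
    positivity

lemma weightedMean_odd_axis (p : ℕ) {φ : E (2 * p + 3) → ℝ} (hφ : Continuous φ) (hrad : Radial φ)
    {r t t₁ : ℝ} (ht : 0 < t) (htt : t < t₁) (htr : t₁ ≤ r) :
    weightedMean (2 * p + 3) φ (r • axis _) t =
      ∫ l in Ioo (r - t₁) (r + t₁), φ (l • axis _) * densityOdd p r l *
        truncKernel p (fun ζ => (1 - ζ) ^ p) (simVar r t l) := by
  have hr : 0 < r := by linarith
  have hM := sphereMass_pos (2 * p + 1)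
  have hodd : Odd (2 * p + 3) := ⟨p + 1, by ring⟩
  have h3 : 2 * ((2 * p + 3) / 2) - 1 = 2 * p + 1 := by omega
  rw [weightedMean, mean, if_pos hodd, h3]
  have h1 := integral_comp_mul_eq_of_lintegral (μ := (volume : Measure (E (2 * p + 3))).toSphere)
    (ν := volume.restrict (Ioo (r - t) (r + t)))
    (N := fun ω : sphere (0 : E (2 * p + 3)) 1 => ‖r • axis _ + t • (ω : E (2 * p + 3))‖)
    (k := fun _ => 1)
    (κ := fun l => sphereMass (2 * p + 1) *
      ((1 - ((l ^ 2 - r ^ 2 - t ^ 2) / (2 * r * t)) ^ 2) ^ p * l / (r * t)))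
    (by fun_prop) (by fun_prop) (by fun_prop)
    (fun _ => by positivity) ?_ ?_
    (F := fun l => φ (l • axis _)) (by fun_prop)
  · simp_rw [← hrad.eq_axis, mul_one] at h1
    rw [h1, ← mul_assoc, ← integral_const_mul, setIntegral_eq_of_subset_of_forall_sdiff_eq_zero
      measurableSet_Ioo (s := Ioo (r - t) (r + t)) (t := Ioo (r - t₁) (r + t₁))]
    · refine setIntegral_congr_fun measurableSet_Ioo fun l hl => ?_
      have hl0 : 0 < l := by linarith [hl.1]
      -- Heron's factorization. Its p-th power carries t^{-2p}, and together with the Jacobian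
      -- factor 1/t this cancels the weight t^{2p+1}.
      have e1 : 1 - ((l ^ 2 - r ^ 2 - t ^ 2) / (2 * r * t)) ^ 2 =
          (4 * r * l) ^ 2 / (4 * r ^ 2 * t ^ 2) * (simVar r t l * (1 - simVar r t l)) := by
        unfold simVar
        field_simp
        ring
      rw [truncKernel, if_pos ((simVar_pos_iff ht hr hl0).2 hl), e1, densityOdd, mul_pow, div_pow,
        ← mul_pow, ← pow_mul, mul_pow, mul_pow, mul_pow (4 * r ^ 2), mul_pow, ← pow_mul, ← pow_mul,
        mul_pow]
      field_simp
      ring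
    · exact Ioo_subset_Ioo (by linarith) (by linarith)
    · intro l hl
      rw [truncKernel_simVar_nonpos ht hr (by linarith [hl.1.1]) hl.2]
      simp
  · filter_upwards [ae_restrict_mem measurableSet_Ioo] with l hl
    have hl0 : 0 < l := by linarith [hl.1]
    have : 0 ≤ 1 - ((l ^ 2 - r ^ 2 - t ^ 2) / (2 * r * t)) ^ 2 := by
      rw [sub_nonneg, sq_le_one_iff_abs_le_one, abs_div, abs_of_pos (by positivity : 0 < 2 * r * t),
        div_le_one (by positivity), abs_le]
      constructor <;> nlinarith [hl.1, hl.2]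
    show (0 : ℝ) ≤ _
    positivity
  · intro f hf
    simp only [ENNReal.ofReal_one, mul_one]
    rw [lintegral_sphere_norm_odd p ht (htt.trans_le htr) hf, ← ofReal_sphereMass,
      ← lintegral_const_mul' _ _ ENNReal.ofReal_ne_top]
    refine lintegral_congr fun l => ?_
    rw [ENNReal.ofReal_mul hM.le]
    ring

end ConvWave

/-! ### Smoothness of the kernels and differentiation in time. -/

namespace ConvWave
open Set Metric Filter Topology
open scoped ENNReal ContDiff

lemma exists_bound_of_continuousOn_Ioo {G : ℝ → ℝ} (hG : ContinuousOn G (Ioo (-1) 1)) {ρ : ℝ}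
    (hρ : ρ < 1) : ∃ C, 0 ≤ C ∧ ∀ x, |x| ≤ ρ → |G x| ≤ C := by
  obtain ⟨C, hC⟩ := (isCompact_Icc (a := -ρ) (b := ρ)).exists_bound_of_continuousOn
    (hG.mono (Icc_subset_Ioo (by linarith) hρ))
  exact ⟨max C 0, le_max_right _ _, fun x hx => (hC x (abs_le.1 hx)).trans (le_max_left _ _)⟩

/-- For 0 < σ < 1 and |ζ| ≤ ρ < 1 the argument ζσ stays in [-ρ, ρ], where `g` and its derivative are
bounded; a multiple of |w| is the dominating function. -/
lemma hasDerivAt_integral_comp_mul {w g : ℝ → ℝ} (hw : IntegrableOn w (Ioo 0 1))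
    (hg : Measurable g) (hgs : ContDiffOn ℝ ∞ g (Ioo (-1) 1)) {ζ : ℝ} (hζ : ζ ∈ Ioo (-1 : ℝ) 1) :
    HasDerivAt (fun ζ => ∫ σ in Ioo (0 : ℝ) 1, w σ * g (ζ * σ))
      (∫ σ in Ioo (0 : ℝ) 1, (w σ * σ) * deriv g (ζ * σ)) ζ := by
  obtain ⟨ρ, hρ1, hρ2⟩ := exists_between (abs_lt.2 hζ)
  have hg' := hgs.deriv_of_isOpen (m := ∞) isOpen_Ioo (by simp)
  obtain ⟨C, hC0, hC⟩ := exists_bound_of_continuousOn_Ioo hgs.continuousOn hρ2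
  obtain ⟨C', hC0', hC'⟩ := exists_bound_of_continuousOn_Ioo hg'.continuousOn hρ2
  have hsmall : ∀ σ ∈ Ioo (0 : ℝ) 1, ∀ x, |x| ≤ ρ → |x * σ| ≤ ρ := by
    intro σ hσ x hx
    rw [abs_mul, abs_of_pos hσ.1]
    exact (mul_le_of_le_one_right (abs_nonneg x) hσ.2.le).trans hx
  refine (hasDerivAt_integral_of_dominated_loc_of_deriv_le (s := Ioo (-ρ) ρ)
    (F := fun ζ σ => w σ * g (ζ * σ)) (F' := fun ζ σ => (w σ * σ) * deriv g (ζ * σ))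
    (bound := fun σ => |w σ| * C') (Ioo_mem_nhds (abs_lt.1 hρ1).1 (abs_lt.1 hρ1).2)
    (.of_forall fun x => hw.aestronglyMeasurable.mul
      (by fun_prop : Measurable fun σ => g (x * σ)).aestronglyMeasurable) ?_ ?_ ?_ ?_ ?_).2
  · refine Integrable.mul_bdd (c := C) hw
      (by fun_prop : Measurable fun σ => g (ζ * σ)).aestronglyMeasurable ?_
    filter_upwards [ae_restrict_mem measurableSet_Ioo] with σ hσ
    exact hC _ (hsmall σ hσ ζ hρ1.le)
  · have := measurable_deriv g
    exact (hw.aestronglyMeasurable.mul measurable_id.aestronglyMeasurable).mul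
      (by fun_prop : Measurable fun σ => deriv g (ζ * σ)).aestronglyMeasurable
  · filter_upwards [ae_restrict_mem measurableSet_Ioo] with σ hσ x hx
    have h1 := hC' _ (hsmall σ hσ x (abs_lt.2 hx).le)
    rw [norm_mul, norm_mul, Real.norm_eq_abs, Real.norm_eq_abs, Real.norm_eq_abs, abs_of_pos hσ.1]
    have := mul_le_of_le_one_right (abs_nonneg (w σ)) hσ.2.le
    exact mul_le_mul this h1 (abs_nonneg _) (abs_nonneg _)
  · exact hw.abs.mul_const C'
  · filter_upwards [ae_restrict_mem measurableSet_Ioo] with σ hσ x hx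
    have h1 := abs_lt.1 ((hsmall σ hσ x (abs_lt.2 hx).le).trans_lt hρ2)
    have h2 := ((hgs.contDiffAt (isOpen_Ioo.mem_nhds h1)).differentiableAt (by simp)).hasDerivAt
    have h3 : HasDerivAt (fun x : ℝ => x * σ) σ x := by
      simpa using (hasDerivAt_id x).mul_const σ
    refine ((h2.comp x h3).const_mul (w σ)).congr_deriv ?_
    ring

/-- The derivative is an integral of the same form, with weight w(σ)σ and g' in place of g, so the
induction on the order runs over all `w` and `g`. -/
lemma contDiffOn_integral_comp_mul {w g : ℝ → ℝ} (hw : IntegrableOn w (Ioo 0 1))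
    (hg : Measurable g) (hgs : ContDiffOn ℝ ∞ g (Ioo (-1) 1)) :
    ContDiffOn ℝ ∞ (fun ζ => ∫ σ in Ioo (0 : ℝ) 1, w σ * g (ζ * σ)) (Ioo (-1) 1) := by
  rw [contDiffOn_infty]
  intro n
  induction n generalizing w g with
  | zero =>
    exact contDiffOn_zero.2 fun ζ hζ =>
      (hasDerivAt_integral_comp_mul hw hg hgs hζ).continuousAt.continuousWithinAt
  | succ n ih =>
    push_cast
    refine (contDiffOn_succ_iff_deriv_of_isOpen isOpen_Ioo).2 ⟨fun ζ hζ =>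
      (hasDerivAt_integral_comp_mul hw hg hgs hζ).differentiableAt.differentiableWithinAt,
      by simp, ?_⟩
    have hw' : IntegrableOn (fun σ => w σ * σ) (Ioo 0 1) := by
      refine Integrable.mul_bdd (c := 1) hw measurable_id.aestronglyMeasurable ?_
      filter_upwards [ae_restrict_mem measurableSet_Ioo] with σ hσ
      rw [Real.norm_of_nonneg hσ.1.le]
      exact hσ.2.le
    exact (ih hw' (measurable_deriv g) (hgs.deriv_of_isOpen isOpen_Ioo (by simp))).congr
      fun ζ hζ => (hasDerivAt_integral_comp_mul hw hg hgs hζ).deriv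

lemma contDiffOn_kernelEven (p : ℕ) : ContDiffOn ℝ ∞ (kernelEven p) (Ioo (-1) 1) := by
  refine contDiffOn_integral_comp_mul (g := fun x => (1 - x) ^ p / √(1 - x))
    (integrableOn_arcsineWeight p) (by fun_prop) ?_
  intro x hx
  have : 0 < 1 - x := by linarith [hx.2]
  refine ContDiffAt.contDiffWithinAt (ContDiffAt.div (by fun_prop) ?_ (Real.sqrt_pos.2 this).ne')
  exact ContDiffAt.sqrt (by fun_prop) this.ne'

lemma kernelEven_zero_pos (p : ℕ) : 0 < kernelEven p 0 := by
  unfold kernelEven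
  simp only [zero_mul, sub_zero, one_pow, Real.sqrt_one, div_one, mul_one]
  rw [setIntegral_pos_iff_support_of_nonneg_ae _ (integrableOn_arcsineWeight p)]
  · have : Function.support (arcsineWeight p) ∩ Ioo 0 1 = Ioo 0 1 :=
      inter_eq_right.2 fun σ hσ => (arcsineWeight_pos p hσ).ne'
    rw [this]
    simp
  · filter_upwards [ae_restrict_mem measurableSet_Ioo] with σ hσ
    exact (arcsineWeight_pos p hσ).le

/-- The factor of the derivative of `ζ^{p+1} G`. -/
def kernelStep (p : ℕ) (G : ℝ → ℝ) (ζ : ℝ) : ℝ := (p + 1) * G ζ + ζ * deriv G ζ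

/-- The product rule leaves a factor ζ^p on the positive side. The point ζ = 0 is excluded because
for p = 0 the derivative may jump there from 0 to G(0). -/
lemma hasDerivAt_truncKernel_succ (p : ℕ) {G : ℝ → ℝ} {ζ : ℝ} (hG : DifferentiableAt ℝ G ζ)
    (hζ : ζ ≠ 0) :
    HasDerivAt (truncKernel (p + 1) G) (truncKernel p (kernelStep p G) ζ) ζ := by
  rcases lt_or_gt_of_ne hζ with h | h
  · rw [truncKernel, if_neg h.not_gt]
    refine (hasDerivAt_const ζ 0).congr_of_eventuallyEq ?_
    filter_upwards [Iio_mem_nhds h] with x hx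
    rw [truncKernel, if_neg (not_lt.2 (le_of_lt hx))]
  · rw [truncKernel, if_pos h]
    have h1 := (hasDerivAt_pow (p + 1) ζ).mul hG.hasDerivAt
    refine (h1.congr_of_eventuallyEq ?_).congr_deriv ?_
    · filter_upwards [Ioi_mem_nhds h] with x hx
      rw [truncKernel, if_pos (mem_Ioi.1 hx)]
      rfl
    · simp only [kernelStep, Nat.add_sub_cancel]
      push_cast
      ring

/-- The truncation is q(max(ζ,0)) with q smooth and q(0) = 0. The Lipschitz bound replaces the
derivative bound that may be unavailable at ζ = 0. -/
lemma lipschitz_truncKernel_succ (p : ℕ) {G : ℝ → ℝ} (hG : ContDiffOn ℝ ∞ G (Ioo (-1) 1)) :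
    ∃ C : ℝ, 0 ≤ C ∧ ∀ x y : ℝ, |x| ≤ 1 / 2 → |y| ≤ 1 / 2 →
      |truncKernel (p + 1) G x - truncKernel (p + 1) G y| ≤ C * |x - y| := by
  set q : ℝ → ℝ := fun ζ => ζ ^ (p + 1) * G ζ with hq
  have hqs : ContDiffOn ℝ ∞ q (Ioo (-1) 1) := (contDiff_id.pow _).contDiffOn.mul hG
  have hq' := hqs.deriv_of_isOpen (m := ∞) isOpen_Ioo (by simp)
  obtain ⟨C, hC0, hC⟩ := exists_bound_of_continuousOn_Ioo hq'.continuousOn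
    (by norm_num : (1 / 2 : ℝ) < 1)
  have htr : ∀ x, truncKernel (p + 1) G x = q (max x 0) := by
    intro x
    unfold truncKernel
    split_ifs with h
    · rw [max_eq_left h.le]
    · rw [max_eq_right (not_lt.1 h)]; simp [hq]
  have hmax : ∀ x : ℝ, |x| ≤ 1 / 2 → max x 0 ∈ Icc (-(1 / 2) : ℝ) (1 / 2) := fun x hx =>
    ⟨(by norm_num : -(1 / 2 : ℝ) ≤ 0).trans (le_max_right _ _),
      max_le (abs_le.1 hx).2 (by norm_num)⟩
  refine ⟨C, hC0, fun x y hx hy => ?_⟩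
  have := (convex_Icc (-(1 / 2) : ℝ) (1 / 2)).norm_image_sub_le_of_norm_deriv_le (f := q) (C := C)
    (fun z hz => (hqs.contDiffAt (Ioo_mem_nhds (by linarith [hz.1])
      (by linarith [hz.2]))).differentiableAt (by simp))
    (fun z hz => hC z (abs_le.2 hz)) (hmax y hy) (hmax x hx)
  rw [htr, htr]
  refine this.trans (mul_le_mul_of_nonneg_left ?_ hC0)
  exact abs_max_sub_max_le_abs x y 0

lemma abs_simVar_le {r t t₁ l : ℝ} (ht : 0 < t) (htt : t < t₁) (htr : t₁ ≤ r / 2)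
    (hl : l ∈ Ioo (r - t₁) (r + t₁)) : |simVar r t l| ≤ 1 / 2 := by
  have hr : 0 < r := by linarith
  have hl0 : r / 2 < l := by linarith [hl.1]
  have hl1 : 0 < l := by linarith
  rw [simVar, abs_div, abs_of_pos (by positivity : 0 < 4 * r * l), div_le_iff₀ (by positivity),
    abs_le]
  have h1 : t ^ 2 ≤ r ^ 2 / 4 := by nlinarith
  have h2 : (r - l) ^ 2 ≤ r ^ 2 / 4 := by nlinarith [hl.1, hl.2]
  constructor <;> nlinarith [sq_nonneg t, sq_nonneg (r - l)]

/-- Dominated differentiation in its Lipschitz form: the integrand needs to be differentiable in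
time only for almost every l, and the kink ζ = 0 is met only at l = r ± t. -/
lemma hasDerivAt_integral_truncKernel (p : ℕ) {G : ℝ → ℝ} (hGm : Measurable G)
    (hG : ContDiffOn ℝ ∞ G (Ioo (-1) 1)) {r t₁ : ℝ} (htr : t₁ ≤ r / 2) {h : ℝ → ℝ}
    (hh : IntegrableOn h (Ioo (r - t₁) (r + t₁))) {t : ℝ} (ht : t ∈ Ioo 0 t₁) :
    HasDerivAt (fun t => ∫ l in Ioo (r - t₁) (r + t₁), h l * truncKernel (p + 1) G (simVar r t l))
      (∫ l in Ioo (r - t₁) (r + t₁),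
        h l * (truncKernel p (kernelStep p G) (simVar r t l) * (2 * t / (4 * r * l)))) t := by
  have hr : 0 < r := by linarith [ht.1, ht.2]
  obtain ⟨C, hC0, hC⟩ := lipschitz_truncKernel_succ p hG
  have hm1 : ∀ t, AEStronglyMeasurable (fun l => truncKernel (p + 1) G (simVar r t l))
      (volume.restrict (Ioo (r - t₁) (r + t₁))) := fun t =>
    ((measurable_truncKernel (p + 1) hGm).comp (measurable_simVar r t)).aestronglyMeasurable
  have hstep : Measurable (kernelStep p G) := by
    have := measurable_deriv G
    unfold kernelStep
    fun_prop
  have hm2 : Measurable (fun l => truncKernel p (kernelStep p G) (simVar r t l)) :=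
    (measurable_truncKernel p hstep).comp (measurable_simVar r t)
  refine (hasDerivAt_integral_of_dominated_loc_of_lip (s := Ioo 0 t₁)
    (F := fun t l => h l * truncKernel (p + 1) G (simVar r t l))
    -- The difference of ζ at times a and b is (a+b)(a-b)/(4rl), and a+b ≤ 2t₁ while 4rl ≥ 2r².
    (bound := fun l => |h l| * (C * (t₁ / (r * r)))) (Ioo_mem_nhds ht.1 ht.2)
    (.of_forall fun x => hh.aestronglyMeasurable.mul (hm1 x)) ?_ ?_ ?_ ?_ ?_).2
  · refine Integrable.mul_bdd (c := C * (1 / 2)) hh (hm1 t) ?_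
    filter_upwards [ae_restrict_mem measurableSet_Ioo] with l hl
    have h1 := abs_simVar_le ht.1 ht.2 htr hl
    have h2 := hC _ 0 h1 (by norm_num)
    have h3 : truncKernel (p + 1) G 0 = 0 := by simp [truncKernel]
    rw [h3, sub_zero, sub_zero] at h2
    exact h2.trans (mul_le_mul_of_nonneg_left h1 hC0)
  · exact hh.aestronglyMeasurable.mul
      (hm2.mul (by fun_prop : Measurable fun l : ℝ => 2 * t / (4 * r * l))).aestronglyMeasurable
  · filter_upwards [ae_restrict_mem measurableSet_Ioo] with l hl
    have hl0 : r / 2 < l := by linarith [hl.1]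
    have hl1 : 0 < l := by linarith
    refine LipschitzOnWith.of_dist_le_mul fun a ha b hb => ?_
    rw [Real.dist_eq, Real.dist_eq, ← mul_sub, abs_mul, Real.coe_nnabs,
      abs_of_nonneg (a := |h l| * (C * (t₁ / (r * r)))) (by have := ht.1.trans ht.2; positivity)]
    have h1 := hC _ _ (abs_simVar_le ha.1 ha.2 htr hl) (abs_simVar_le hb.1 hb.2 htr hl)
    have h2 : |simVar r a l - simVar r b l| ≤ t₁ / (r * r) * |a - b| := by
      have e : simVar r a l - simVar r b l = (a + b) / (4 * r * l) * (a - b) := by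
        unfold simVar; field_simp; ring
      rw [e, abs_mul]
      refine mul_le_mul_of_nonneg_right ?_ (abs_nonneg _)
      rw [abs_of_nonneg (by have := ha.1; have := hb.1; positivity),
        div_le_div_iff₀ (by positivity) (by positivity)]
      have h3 : a + b ≤ 2 * t₁ := by linarith [ha.2, hb.2]
      have h4 : 0 < t₁ := ht.1.trans ht.2
      have h5 : r * r ≤ 2 * (r * l) := by nlinarith
      calc (a + b) * (r * r) ≤ (2 * t₁) * (2 * (r * l)) := by
            apply mul_le_mul h3 h5 (by positivity) (by positivity)
        _ = t₁ * (4 * r * l) := by ring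
    calc |h l| * _ ≤ |h l| * (C * (t₁ / (r * r) * |a - b|)) :=
          mul_le_mul_of_nonneg_left (h1.trans (mul_le_mul_of_nonneg_left h2 hC0)) (abs_nonneg _)
      _ = _ := by ring
  · exact hh.abs.mul_const _
  · have hne : ∀ᵐ l : ℝ, l ≠ r - t ∧ l ≠ r + t := by
      have h1 : ∀ᵐ l : ℝ, l ≠ r - t := Measure.ae_ne volume _
      have h2 : ∀ᵐ l : ℝ, l ≠ r + t := Measure.ae_ne volume _
      filter_upwards [h1, h2] with l a b using ⟨a, b⟩
    filter_upwards [ae_restrict_mem measurableSet_Ioo, ae_restrict_of_ae hne] with l hl hl'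
    have hl0 : r / 2 < l := by linarith [hl.1]
    have hl1 : 0 < l := by linarith
    have h1 := abs_lt.1 ((abs_simVar_le ht.1 ht.2 htr hl).trans_lt (by norm_num : (1 / 2 : ℝ) < 1))
    have h2 : simVar r t l ≠ 0 := by
      rw [simVar, div_ne_zero_iff]
      refine ⟨?_, by positivity⟩
      have : t ^ 2 - (r - l) ^ 2 = (l - (r - t)) * (r + t - l) := by ring
      rw [this]
      exact mul_ne_zero (sub_ne_zero.2 hl'.1) (sub_ne_zero.2 hl'.2.symm)
    have h3 : HasDerivAt (fun t => simVar r t l) (2 * t / (4 * r * l)) t := by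
      have := ((hasDerivAt_pow 2 t).sub_const ((r - l) ^ 2)).div_const (4 * r * l)
      exact this.congr_deriv (by norm_num)
    have h4 := hasDerivAt_truncKernel_succ p
      ((hG.contDiffAt (isOpen_Ioo.mem_nhds h1)).differentiableAt (by simp)) h2
    exact (h4.comp t h3).const_mul (h l)

/-- Iterating `(1/t) ∂_t` on a superposition of kernels `ζ^p G(ζ)`. -/
theorem radialDeriv_iterate_kernel (p : ℕ) {G : ℝ → ℝ} (hGm : Measurable G)
    (hG : ContDiffOn ℝ ∞ G (Ioo (-1) 1)) (hG0 : 0 < G 0) :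
    ∃ Q : ℝ → ℝ, Measurable Q ∧ ContinuousOn Q (Ioo (-1) 1) ∧ 0 < Q 0 ∧
      ∀ r t₁ : ℝ, t₁ ≤ r / 2 → ∀ h : ℝ → ℝ, IntegrableOn h (Ioo (r - t₁) (r + t₁)) →
      ∀ ψ : ℝ → ℝ, (∀ t ∈ Ioo 0 t₁, ψ t =
        ∫ l in Ioo (r - t₁) (r + t₁), h l * truncKernel p G (simVar r t l)) →
      ∀ t ∈ Ioo 0 t₁, radialDeriv^[p] ψ t = ∫ l in Ioo (r - t₁) (r + t₁),
        h l * (2 / (4 * r * l)) ^ p * truncKernel 0 Q (simVar r t l) := by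
  induction p generalizing G with
  | zero =>
    refine ⟨G, hGm, hG.continuousOn, hG0, fun r t₁ _ h _ ψ hψ t ht => ?_⟩
    simpa using hψ t ht
  | succ p ih =>
    have hstep : Measurable (kernelStep p G) := by
      have := measurable_deriv G
      unfold kernelStep
      fun_prop
    -- At ζ = 0 the new factor equals (p+1)G(0), so positivity there survives each step.
    obtain ⟨Q, hQm, hQc, hQ0, hQ⟩ := ih hstep
      ((contDiffOn_const.mul hG).add (contDiffOn_id.mul (hG.deriv_of_isOpen isOpen_Ioo (by simp))))
      (by simp only [kernelStep, zero_mul, add_zero]; positivity)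
    refine ⟨Q, hQm, hQc, hQ0, fun r t₁ htr h hh ψ hψ t ht => ?_⟩
    have hr : 0 < r := by linarith [ht.1, ht.2]
    -- The 1/t of the operator cancels the t in ∂_t ζ = 2t/(4rl); the remaining 2/(4rl) does not
    -- involve time and is absorbed into the density `h`.
    rw [Function.iterate_succ_apply, hQ r t₁ htr (fun l => h l * (2 / (4 * r * l))) ?_ _ ?_ t ht]
    · refine integral_congr_ae (.of_forall fun l => ?_)
      dsimp only
      ring
    · refine Integrable.mul_bdd (c := 1 / (r * r)) hh
        (by fun_prop : Measurable fun l : ℝ => 2 / (4 * r * l)).aestronglyMeasurable ?_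
      filter_upwards [ae_restrict_mem measurableSet_Ioo] with l hl
      have hl0 : r / 2 < l := by linarith [hl.1]
      have hl1 : 0 < l := by linarith
      rw [Real.norm_of_nonneg (by positivity), div_le_div_iff₀ (by positivity) (by positivity)]
      nlinarith
    · intro s hs
      have h1 := (hasDerivAt_integral_truncKernel p hGm hG htr hh hs).congr_of_eventuallyEq
        (f₁ := ψ) (by filter_upwards [isOpen_Ioo.mem_nhds hs] with x hx using hψ x hx)
      rw [radialDeriv, h1.deriv, ← integral_const_mul]
      refine integral_congr_ae (.of_forall fun l => ?_)
      have := hs.1.ne'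
      dsimp only
      field_simp

end ConvWave

/-! ### Rotation invariance and the lower bound for the solution operator. -/

namespace ConvWave
open Set Metric Filter Topology
open scoped ENNReal ContDiff Pointwise

lemma exists_isometry_apply_eq {n : ℕ} {x y : E n} (h : ‖x‖ = ‖y‖) :
    ∃ O : E n ≃ₗᵢ[ℝ] E n, O x = y :=
  ⟨_, Submodule.reflection_sub h⟩

/-- A linear isometry acting on the unit sphere. -/
def sphereMap {n : ℕ} (O : E n ≃ₗᵢ[ℝ] E n) (v : sphere (0 : E n) 1) : sphere (0 : E n) 1 :=
  ⟨O v, by simp⟩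

lemma continuous_sphereMap {n : ℕ} (O : E n ≃ₗᵢ[ℝ] E n) : Continuous (sphereMap O) :=
  (O.continuous.comp continuous_subtype_val).subtype_mk _

/-- The surface measure of a set is the dimension times the volume of the cone over it. An isometry
preserves volume and carries cones to cones. -/
lemma measurePreserving_sphereMap {n : ℕ} (O : E n ≃ₗᵢ[ℝ] E n) :
    MeasurePreserving (sphereMap O) (volume : Measure (E n)).toSphere
      (volume : Measure (E n)).toSphere := by
  refine ⟨(continuous_sphereMap O).measurable, ?_⟩
  ext s hs
  have hpre : MeasurableSet (sphereMap O ⁻¹' s) := (continuous_sphereMap O).measurable hs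
  rw [Measure.map_apply (continuous_sphereMap O).measurable hs, Measure.toSphere_apply' _ hpre,
    Measure.toSphere_apply' _ hs]
  congr 1
  rw [← O.measurePreserving.measure_preimage_equiv
    (f := O.toMeasurableEquiv) (Ioo (0 : ℝ) 1 • ((↑) '' s : Set (E n)))]
  congr 1
  ext y
  simp only [Set.mem_smul, mem_image, mem_preimage]
  constructor
  · rintro ⟨a, ha, _, ⟨v, hv, rfl⟩, rfl⟩
    exact ⟨a, ha, O v, ⟨sphereMap O v, hv, rfl⟩, (O.map_smul a v).symm⟩
  · rintro ⟨a, ha, _, ⟨v, hv, rfl⟩, h⟩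
    refine ⟨a, ha, O.symm v, ⟨sphereMap O.symm v, ?_, rfl⟩, ?_⟩
    · have : sphereMap O (sphereMap O.symm v) = v := Subtype.ext (O.apply_symm_apply v)
      rwa [← this] at hv
    · apply O.injective
      rw [O.map_smul, O.apply_symm_apply]
      exact h

lemma mean_comp_isometry {n : ℕ} (O : E n ≃ₗᵢ[ℝ] E n) (φ : E n → ℝ) (x : E n) (t : ℝ) :
    mean n (fun y => φ (O y)) x t = mean n φ (O x) t := by
  unfold mean
  split_ifs
  · congr 1
    have he : MeasurableEmbedding (sphereMap O) := by
      refine (Topology.IsClosedEmbedding.measurableEmbedding ?_)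
      refine (continuous_sphereMap O).isClosedEmbedding fun a b hab => ?_
      exact Subtype.ext (O.injective (congrArg Subtype.val hab))
    rw [← (measurePreserving_sphereMap O).integral_comp he (fun v => φ (O x + t • (v : E n)))]
    simp [sphereMap]
  · congr 1
    have := O.measurePreserving.setIntegral_preimage_emb O.toMeasurableEquiv.measurableEmbedding
      (fun ξ => φ (O x + t • ξ) / √(1 - ‖ξ‖ ^ 2)) (closedBall 0 1)
    rw [← this]
    have hpre : O ⁻¹' closedBall (0 : E n) 1 = closedBall 0 1 := by
      ext y; simp
    rw [hpre]
    simp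

lemma weightedMean_comp_isometry {n : ℕ} (O : E n ≃ₗᵢ[ℝ] E n) (φ : E n → ℝ) (x : E n) :
    weightedMean n (fun y => φ (O y)) x = weightedMean n φ (O x) := by
  ext t
  rw [weightedMean, weightedMean, mean_comp_isometry]

lemma waveOp_of_two_le {n : ℕ} (hn : 2 ≤ n) (φ : E n → ℝ) (x : E n) (t : ℝ) :
    waveOp n φ x t = (1 / (Nat.doubleFactorial (2 * (n / 2) - 1) : ℝ)) *
        (radialDeriv^[n / 2 - 1] (weightedMean n φ x)) t := by
  obtain ⟨k, rfl⟩ : ∃ k, n = k + 2 := ⟨n - 2, by omega⟩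
  rfl

lemma waveOp_comp_isometry {n : ℕ} (hn : 2 ≤ n) (O : E n ≃ₗᵢ[ℝ] E n) (φ : E n → ℝ) (x : E n)
    (t : ℝ) : waveOp n (fun y => φ (O y)) x t = waveOp n φ (O x) t := by
  rw [waveOp_of_two_le hn, waveOp_of_two_le hn, weightedMean_comp_isometry]

lemma waveOpDefinedAt_comp_isometry {n : ℕ} (O : E n ≃ₗᵢ[ℝ] E n) (φ : E n → ℝ) (x : E n) (t : ℝ) :
    WaveOpDefinedAt n (fun y => φ (O y)) x t ↔ WaveOpDefinedAt n φ (O x) t := by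
  unfold WaveOpDefinedAt
  rw [weightedMean_comp_isometry]

lemma weightedMean_radial_eq_axis {k : ℕ} {φ : E (k + 1) → ℝ} (hrad : Radial φ) {e : E (k + 1)}
    (he : ‖e‖ = 1) (r : ℝ) : weightedMean (k + 1) φ (r • e) = weightedMean (k + 1) φ (r • axis k) := by
  obtain ⟨O, hO⟩ := exists_isometry_apply_eq (x := axis k) (y := e) (by rw [norm_axis, he])
  have h1 : (fun y => φ (O y)) = φ := funext fun y => hrad _ _ (O.norm_map y)
  rw [← hO, ← O.map_smul, ← weightedMean_comp_isometry, h1]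

/-- The spherical means of a radial function as a superposition of kernels `ζ^p G(ζ)`. -/
lemma exists_weightedMean_kernel {n : ℕ} (hn : 2 ≤ n) :
    ∃ G : ℝ → ℝ, Measurable G ∧ ContDiffOn ℝ ∞ G (Ioo (-1) 1) ∧ 0 < G 0 ∧
      ∃ H : ℝ → ℝ → ℝ, (∀ r, 0 < r → ContinuousOn (H r) (Ioi 0)) ∧
        (∀ r, 0 < r → ∀ l, 0 < l → 0 < H r l) ∧
        ∀ φ : E n → ℝ, Continuous φ → Radial φ → ∀ e : E n, ‖e‖ = 1 → ∀ r t t₁ : ℝ, 0 < t → t < t₁ →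
          t₁ ≤ r → weightedMean n φ (r • e) t = ∫ l in Ioo (r - t₁) (r + t₁),
            φ (l • e) * H r l * truncKernel (n / 2 - 1) G (simVar r t l) := by
  have hparity : (∃ p, n = 2 * p + 2) ∨ ∃ p, n = 2 * p + 3 := by
    rcases Nat.even_or_odd' n with ⟨k, h | h⟩
    · exact Or.inl ⟨k - 1, by omega⟩
    · exact Or.inr ⟨k - 1, by omega⟩
  rcases hparity with ⟨p, rfl⟩ | ⟨p, rfl⟩
  · refine ⟨kernelEven p, measurable_kernelEven p, contDiffOn_kernelEven p, kernelEven_zero_pos p,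
      densityEven p, fun r hr => continuousOn_densityEven p hr,
      fun r hr l hl => densityEven_pos p hr hl, fun φ hφ hrad e he r t t₁ ht htt htr => ?_⟩
    rw [weightedMean_radial_eq_axis hrad he, weightedMean_even_axis p hφ hrad ht htt htr,
      show (2 * p + 2) / 2 - 1 = p by omega]
    simp_rw [fun l : ℝ => hrad (l • e) (l • axis _) (by rw [norm_smul, norm_smul, he, norm_axis])]
  · refine ⟨fun ζ => (1 - ζ) ^ p, by fun_prop, by fun_prop, by simp,
      densityOdd p, fun r _ => (continuous_densityOdd p r).continuousOn,
      fun r hr l hl => densityOdd_pos p hr hl, fun φ hφ hrad e he r t t₁ ht htt htr => ?_⟩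
    rw [weightedMean_radial_eq_axis hrad he, weightedMean_odd_axis p hφ hrad ht htt htr,
      show (2 * p + 3) / 2 - 1 = p by omega]
    simp_rw [fun l : ℝ => hrad (l • e) (l • axis _) (by rw [norm_smul, norm_smul, he, norm_axis])]

/-- For radial data and small times the solution operator is integration against a nonnegative
kernel. -/
lemma exists_waveOp_kernel {n : ℕ} (hn : 2 ≤ n) :
    ∃ δ : ℝ, 0 < δ ∧ δ ≤ 1 / 4 ∧ ∃ K : ℝ → ℝ → ℝ → ℝ,
      (∀ r t l, 0 < t → t ≤ δ * r → l ∈ Ioo (r / 2) (3 * r / 2) → 0 ≤ K r t l) ∧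
      (∀ r t l, 0 < t → t ≤ δ * r → l ∈ Ioo (r / 2) (3 * r / 2) → t < |l - r| → K r t l = 0) ∧
      ∀ φ : E n → ℝ, Continuous φ → Radial φ → ∀ e : E n, ‖e‖ = 1 → ∀ r t : ℝ, 0 < t → t ≤ δ * r →
        IntegrableOn (fun l => φ (l • e) * K r t l) (Ioo (r / 2) (3 * r / 2)) ∧
        waveOp n φ (r • e) t = ∫ l in Ioo (r / 2) (3 * r / 2), φ (l • e) * K r t l := by
  obtain ⟨G, hGm, hG, hG0, H, hHc, hH0, hH⟩ := exists_weightedMean_kernel hn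
  obtain ⟨Q, hQm, hQc, hQ0, hQ⟩ := radialDeriv_iterate_kernel (n / 2 - 1) hGm hG hG0
  set p := n / 2 - 1
  -- This η fixes δ: where ζ > 0 it is at most t²/(4rl), and l > r/2 makes this less than t²/(2r²),
  -- so a small t/r keeps ζ where Q is positive.
  obtain ⟨η, hη0, hη⟩ : ∃ η > 0, ∀ ζ, |ζ| < η → 0 < Q ζ := by
    have h1 := (hQc.continuousAt (Ioo_mem_nhds (by norm_num) (by norm_num))).eventually
      (lt_mem_nhds hQ0)
    obtain ⟨η, h2, h3⟩ := Metric.eventually_nhds_iff.1 h1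
    exact ⟨η, h2, fun ζ hζ => h3 (by simpa using hζ)⟩
  obtain ⟨C, hC0, hC⟩ := exists_bound_of_continuousOn_Ioo hQc (by norm_num : (1 / 2 : ℝ) < 1)
  refine ⟨min (1 / 4) η, lt_min (by norm_num) hη0, min_le_left _ _,
    fun r t l => (1 / (Nat.doubleFactorial (2 * (n / 2) - 1) : ℝ)) *
      (H r l * (2 / (4 * r * l)) ^ p * truncKernel 0 Q (simVar r t l)), ?_, ?_, ?_⟩
  · intro r t l ht htr hl
    have h1 : t ≤ r / 4 := by
      by_contra h
      have : min (1 / 4) η * r ≤ 1 / 4 * r :=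
        mul_le_mul_of_nonneg_right (min_le_left _ _) (by linarith [hl.1, hl.2])
      linarith
    have hr : 0 < r := by linarith
    have hl0 : 0 < l := by linarith [hl.1]
    have h2 := (hH0 r hr l hl0).le
    have h3 : 0 ≤ truncKernel 0 Q (simVar r t l) := by
      unfold truncKernel
      split_ifs with h
      · rw [pow_zero, one_mul]
        refine (hη _ ?_).le
        have h4 : t ≤ η * r := htr.trans (mul_le_mul_of_nonneg_right (min_le_right _ _) hr.le)
        rw [abs_of_pos h, simVar, div_lt_iff₀ (by positivity)]
        have h5 : t * t ≤ (η * r) * (r / 4) := mul_le_mul h4 h1 ht.le (by positivity)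
        nlinarith [sq_nonneg (r - l), mul_pos (mul_pos hη0 hr) (sub_pos.2 hl.1), mul_pos hη0 hr,
          mul_pos (mul_pos hη0 hr) hr]
      · exact le_rfl
    positivity
  · intro r t l ht htr hl hlr
    have hr : 0 < r := by linarith [hl.1, hl.2]
    have hl0 : 0 < l := by linarith [hl.1]
    dsimp only
    rw [truncKernel_simVar_nonpos ht hr hl0, mul_zero, mul_zero]
    intro h
    have : |l - r| < t := abs_lt.2 ⟨by linarith [h.1], by linarith [h.2]⟩
    linarith
  · intro φ hφ hrad e he r t ht htr
    have hr : 0 < r := by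
      by_contra h
      have : min (1 / 4) η * r ≤ 0 :=
        mul_nonpos_of_nonneg_of_nonpos (lt_min (by norm_num) hη0).le (not_lt.1 h)
      linarith
    have h1 : t ≤ r / 4 := by
      have := mul_le_mul_of_nonneg_right (min_le_left (1 / 4) η) hr.le
      linarith
    have htt : t ∈ Ioo 0 (r / 2) := ⟨ht, by linarith⟩
    have hI : Ioo (r - r / 2) (r + r / 2) = Ioo (r / 2) (3 * r / 2) := by
      congr 1 <;> ring
    have hpos : ∀ l ∈ Icc (r / 2) (3 * r / 2), 0 < l := fun l hl => by linarith [hl.1]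
    have hcH : ContinuousOn (fun l => φ (l • e) * H r l) (Icc (r / 2) (3 * r / 2)) :=
      (by fun_prop : Continuous fun l : ℝ => φ (l • e)).continuousOn.mul
        ((hHc r hr).mono hpos)
    have hh : IntegrableOn (fun l => φ (l • e) * H r l) (Ioo (r / 2) (3 * r / 2)) :=
      (hcH.integrableOn_compact isCompact_Icc).mono_set Ioo_subset_Icc_self
    have hh2 : IntegrableOn (fun l => φ (l • e) * H r l * (2 / (4 * r * l)) ^ p)
        (Ioo (r / 2) (3 * r / 2)) := by
      refine ((hcH.mul ((ContinuousOn.div continuousOn_const (by fun_prop) fun l hl => ?_).pow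
        p)).integrableOn_compact isCompact_Icc).mono_set Ioo_subset_Icc_self
      have := hpos l hl
      positivity
    have hint : IntegrableOn (fun l => φ (l • e) * H r l * (2 / (4 * r * l)) ^ p *
        truncKernel 0 Q (simVar r t l)) (Ioo (r / 2) (3 * r / 2)) := by
      refine Integrable.mul_bdd (c := C) hh2
        ((measurable_truncKernel 0 hQm).comp (measurable_simVar r t)).aestronglyMeasurable ?_
      filter_upwards [ae_restrict_mem measurableSet_Ioo] with l hl
      have h3 := abs_simVar_le ht htt.2 le_rfl (hI ▸ hl)
      unfold truncKernel
      split_ifs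
      · simpa using hC _ h3
      · simpa using hC0
    have hassoc : ∀ l, φ (l • e) * ((1 / (Nat.doubleFactorial (2 * (n / 2) - 1) : ℝ)) *
        (H r l * (2 / (4 * r * l)) ^ p * truncKernel 0 Q (simVar r t l))) =
        (1 / (Nat.doubleFactorial (2 * (n / 2) - 1) : ℝ)) * (φ (l • e) * H r l *
          (2 / (4 * r * l)) ^ p * truncKernel 0 Q (simVar r t l)) := fun l => by ring
    simp_rw [hassoc]
    refine ⟨hint.const_mul _, ?_⟩
    rw [waveOp_of_two_le hn, integral_const_mul, ← hI]
    congr 1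
    exact hQ r (r / 2) le_rfl (fun l => φ (l • e) * H r l) (hI ▸ hh) _
      (fun s hs => hH φ hφ hrad e he r s (r / 2) hs.1 hs.2 (by linarith)) t htt

/-- The mean of the constant function `1`. -/
def meanOne (n : ℕ) : ℝ := mean n (fun _ => 1) 0 1

lemma mean_one (n : ℕ) (x : E n) (t : ℝ) : mean n (fun _ => 1) x t = meanOne n := rfl

/-- For even n the Bochner integral is positive only once integrability is known: in polar
coordinates the weight 1/√(1-y²) is dominated by the arcsine weight 1/√(y(1-y)). -/
lemma meanOne_pos {n : ℕ} (hn : 1 ≤ n) : 0 < meanOne n := by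
  obtain ⟨k, rfl⟩ : ∃ k, n = k + 1 := ⟨n - 1, by omega⟩
  have h1 := sphereArea_pos k
  have h2 := sphereArea_pos (k + 1)
  unfold meanOne mean
  split_ifs with h
  · have h3 := sphereMass_pos k
    simp only [integral_const, smul_eq_mul, mul_one]
    exact mul_pos (by positivity) h3
  · refine mul_pos (by positivity) ?_
    have h4 : ∫ ξ in closedBall (0 : E (k + 1)) 1, 1 / √(1 - ‖ξ‖ ^ 2) =
        ∫ ξ in ball (0 : E (k + 1)) 1, 1 / √(1 - ‖ξ‖ ^ 2) := by
      refine setIntegral_eq_of_subset_of_forall_sdiff_eq_zero measurableSet_closedBall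
        ball_subset_closedBall fun ξ hξ => ?_
      have h5 : ‖ξ‖ ≤ 1 := by simpa using hξ.1
      have h6 : 1 ≤ ‖ξ‖ := by simpa using hξ.2
      rw [le_antisymm h5 h6]
      simp
    have h5 : IntegrableOn (fun ξ : E (k + 1) => 1 / √(1 - ‖ξ‖ ^ 2)) (ball 0 1) := by
      rw [integrableOn_fun_norm_addHaar volume (f := fun y => 1 / √(1 - y ^ 2))]
      refine Integrable.mono' (integrableOn_arcsineWeight 0) (by fun_prop) ?_
      filter_upwards [ae_restrict_mem measurableSet_Ioo] with y hy
      have h6 := hy.1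
      have h7 : 0 < 1 - y := sub_pos.2 hy.2
      rw [Real.norm_of_nonneg (by positivity), arcsineWeight, pow_zero, smul_eq_mul,
        ← Real.sqrt_mul h6.le]
      refine (mul_le_of_le_one_left (by positivity) (pow_le_one₀ h6.le hy.2.le)).trans ?_
      have h8 : 0 < √(y * (1 - y)) := Real.sqrt_pos.2 (by positivity)
      refine one_div_le_one_div_of_le h8 (Real.sqrt_le_sqrt ?_)
      nlinarith
    rw [h4, setIntegral_pos_iff_support_of_nonneg_ae (.of_forall fun ξ => by
      show (0 : ℝ) ≤ _; positivity) h5]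
    have h6 : Function.support (fun ξ : E (k + 1) => 1 / √(1 - ‖ξ‖ ^ 2)) ∩ ball 0 1 = ball 0 1 := by
      refine inter_eq_right.2 fun ξ hξ => ?_
      have h7 : ‖ξ‖ < 1 := by simpa using hξ
      have h8 : 0 < √(1 - ‖ξ‖ ^ 2) := Real.sqrt_pos.2 (by nlinarith [norm_nonneg ξ])
      exact (one_div_pos.2 h8).ne'
    rw [h6]
    exact measure_ball_pos _ _ one_pos

lemma radialDeriv_iterate_pow (p : ℕ) (c : ℝ) {ψ : ℝ → ℝ}
    (hψ : ∀ t, 0 < t → ψ t = c * t ^ (2 * p + 1)) {t : ℝ} (ht : 0 < t) :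
    radialDeriv^[p] ψ t = c * (Nat.doubleFactorial (2 * p + 1) : ℝ) * t := by
  induction p generalizing ψ c with
  | zero => simpa using hψ t ht
  | succ p ih =>
    rw [Function.iterate_succ_apply, ih (c * (2 * p + 3))]
    · rw [show 2 * (p + 1) + 1 = (2 * p + 1) + 2 by ring, Nat.doubleFactorial_add_two]
      push_cast
      ring
    · intro s hs
      have h1 : HasDerivAt ψ (c * ((2 * p + 3) * s ^ (2 * p + 2))) s := by
        refine ((((hasDerivAt_pow (2 * p + 3) s).const_mul c).congr_of_eventuallyEq
          (f₁ := ψ) ?_)).congr_deriv ?_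
        · filter_upwards [Ioi_mem_nhds hs] with x hx
          exact hψ x hx
        · push_cast
          rfl
      rw [radialDeriv, h1.deriv]
      field_simp
      ring

/-- This gives the total mass of the kernel of W without computing that kernel. The double factorial
produced by the derivatives is the normalizing constant. -/
lemma waveOp_one {n : ℕ} (hn : 2 ≤ n) (x : E n) {t : ℝ} (ht : 0 < t) :
    waveOp n (fun _ => 1) x t = meanOne n * t := by
  rw [waveOp_of_two_le hn, radialDeriv_iterate_pow (n / 2 - 1) (meanOne n) _ ht]
  · have h : 2 * (n / 2 - 1) + 1 = 2 * (n / 2) - 1 := by omega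
    have h0 : (Nat.doubleFactorial (2 * (n / 2) - 1) : ℝ) ≠ 0 := by
      exact_mod_cast (Nat.doubleFactorial_pos _).ne'
    rw [h]
    field_simp
  · intro s _
    rw [weightedMean, mean_one, mul_comm]
    congr 2
    omega

/-- Lower bound for the solution operator: for times small compared with `|x|` it is comparable
with `t` times the infimum of the data over the ball of radius `t` about `x`. -/
theorem exists_waveOp_lower_bound {n : ℕ} (hn : 1 ≤ n) :
    ∃ κ δ : ℝ, 0 < κ ∧ 0 < δ ∧ δ ≤ 1 / 4 ∧ ∀ φ : E n → ℝ, Continuous φ → (2 ≤ n → Radial φ) →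
      ∀ (x : E n) (t : ℝ), 0 < t → t ≤ δ * ‖x‖ → ∀ c : ℝ, (∀ y, ‖y - x‖ ≤ t → c ≤ φ y) →
        c * (κ * t) ≤ waveOp n φ x t := by
  rcases Nat.lt_or_ge n 2 with h | hn2
  · obtain rfl : n = 1 := by omega
    refine ⟨1, 1 / 4, one_pos, by norm_num, le_rfl, fun φ hφ _ x t ht _ c hc => ?_⟩
    have h1 : c * (2 * t) ≤ ∫ y in (x 0 - t)..(x 0 + t), φ (EuclideanSpace.single 0 y) := by
      have h2 : ∫ _ in (x 0 - t)..(x 0 + t), c = c * (2 * t) := by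
        rw [intervalIntegral.integral_const, smul_eq_mul]; ring
      rw [← h2]
      have hcont : Continuous fun y : ℝ => φ (EuclideanSpace.single (0 : Fin 1) y) := by
        have : (fun y : ℝ => EuclideanSpace.single (0 : Fin 1) y) =
            fun y : ℝ => y • EuclideanSpace.single (0 : Fin 1) (1 : ℝ) := by
          ext y i; simp
        refine hφ.comp ?_
        rw [show EuclideanSpace.single (0 : Fin 1) = fun y : ℝ => _ from this]
        fun_prop
      refine intervalIntegral.integral_mono_on (by linarith) (by simp) (hcont.intervalIntegrable _ _)
        fun y hy => hc _ ?_
      rw [EuclideanSpace.norm_eq]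
      simp only [Fin.sum_univ_one, Real.norm_eq_abs, sq_abs, PiLp.sub_apply,
        PiLp.single_apply]
      rw [Real.sqrt_sq_eq_abs, abs_le]
      constructor <;> simp <;> linarith [hy.1, hy.2]
    show c * (1 * t) ≤ (1 / 2) * ∫ y in (x 0 - t)..(x 0 + t), φ (EuclideanSpace.single 0 y)
    linarith
  · obtain ⟨δ, hδ, hδ4, K, hK0, hKz, hK⟩ := exists_waveOp_kernel hn2
    refine ⟨meanOne n, δ, meanOne_pos hn, hδ, hδ4, fun φ hφ hrad x t ht htx c hc => ?_⟩
    have hr : 0 < ‖x‖ := by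
      by_contra h
      have := mul_nonpos_of_nonneg_of_nonpos hδ.le (not_lt.1 h)
      linarith
    set e : E n := ‖x‖⁻¹ • x with he
    have he1 : ‖e‖ = 1 := by rw [he, norm_smul, norm_inv, norm_norm, inv_mul_cancel₀ hr.ne']
    have hx : x = ‖x‖ • e := by rw [he, smul_smul, mul_inv_cancel₀ hr.ne', one_smul]
    obtain ⟨i1, e1⟩ := hK φ hφ (hrad hn2) e he1 ‖x‖ t ht htx
    obtain ⟨i2, e2⟩ := hK (fun _ => 1) continuous_const (fun _ _ _ => rfl) e he1 ‖x‖ t ht htx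
    rw [← hx] at e1 e2
    -- The constant data 1 are represented by the same kernel, so the claim is a pointwise
    -- comparison of `φ` with `c` on the support |l-r| ≤ t, where the kernel is nonnegative.
    rw [← waveOp_one hn2 x ht, e1, e2, ← integral_const_mul]
    refine setIntegral_mono_on (i2.const_mul c) i1 measurableSet_Ioo fun l hl => ?_
    rw [one_mul]
    by_cases hlt : t < |l - ‖x‖|
    · rw [hKz _ _ _ ht htx hl hlt, mul_zero, mul_zero]
    · refine mul_le_mul_of_nonneg_right (hc _ ?_) (hK0 _ _ _ ht htx hl)
      have : l • e - x = (l - ‖x‖) • e := by rw [sub_smul, ← hx]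
      rw [this, norm_smul, he1, mul_one]
      exact not_lt.1 hlt

end ConvWave

/-! ### Radial symmetry of solutions. -/

namespace ConvWave
open Set Metric Filter Topology
open scoped ENNReal

lemma potential_comp_isometry {n : ℕ} (γ : ℝ) (O : E n ≃ₗᵢ[ℝ] E n) (u : E n → ℝ → ℝ) (x : E n)
    (t : ℝ) : potential n γ (fun y s => u (O y) s) x t = potential n γ u (O x) t := by
  unfold potential
  rw [← O.measurePreserving.integral_comp O.toMeasurableEquiv.measurableEmbedding
    (fun y => ‖O x - y‖ ^ (-γ) * u y t ^ 2)]
  simp_rw [← map_sub, O.norm_map]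

lemma nonlin_comp_isometry {n : ℕ} (γ : ℝ) (O : E n ≃ₗᵢ[ℝ] E n) (u : E n → ℝ → ℝ) (x : E n)
    (t : ℝ) : nonlin n γ (fun y s => u (O y) s) x t = nonlin n γ u (O x) t := by
  rw [nonlin, nonlin, potential_comp_isometry]

lemma waveOp_zero (n : ℕ) (hn : 1 ≤ n) (x : E n) (t : ℝ) : waveOp n (fun _ => 0) x t = 0 := by
  rcases Nat.lt_or_ge n 2 with h | h
  · obtain rfl : n = 1 := by omega
    simp [waveOp]
  · rw [waveOp_of_two_le h]
    have h0 : weightedMean n (fun _ => 0) x = fun _ => 0 := by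
      ext s; simp [weightedMean, mean]
    have h1 : radialDeriv (fun _ => (0 : ℝ)) = fun _ => 0 := by
      ext s; simp [radialDeriv]
    rw [h0, Function.iterate_fixed h1, mul_zero]

lemma freeSol_zero (n : ℕ) (hn : 1 ≤ n) (g : E n → ℝ) (x : E n) (t : ℝ) :
    freeSol n (fun _ => 0) g x t = waveOp n g x t := by
  have h : (fun τ => waveOp n (fun _ => 0) x τ) = fun _ => (0 : ℝ) :=
    funext fun τ => waveOp_zero n hn x τ
  rw [freeSol, h]
  simp

lemma duhamelIntegrand_comp_isometry {n : ℕ} (hn : 2 ≤ n) (O : E n ≃ₗᵢ[ℝ] E n)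
    (F : E n → ℝ → ℝ) (x : E n) (t s : ℝ) :
    duhamelIntegrand n (fun y s => F (O y) s) x t s = duhamelIntegrand n F (O x) t s :=
  waveOp_comp_isometry hn O (fun y => F y s / (1 + s) ^ 2) x (t - s)

lemma integrable_comp_isometry {n : ℕ} (O : E n ≃ₗᵢ[ℝ] E n) {f : E n → ℝ} (hf : Integrable f) :
    Integrable fun y => f (O y) :=
  (O.measurePreserving.integrable_comp_emb O.toMeasurableEquiv.measurableEmbedding).2 hf

/-- The equation is invariant under linear isometries when the data are radial. -/
lemma IsSolution.comp_isometry {n : ℕ} (hn : 2 ≤ n) {γ ε : ℝ} {g : E n → ℝ} (hg : Radial g)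
    {T : ℝ≥0∞} {u : E n → ℝ → ℝ} (hu : IsSolution n γ (fun _ => 0) g ε T u)
    (O : E n ≃ₗᵢ[ℝ] E n) :
    IsSolution n γ (fun _ => 0) g ε T (fun x t => u (O x) t) := by
  have hO : Continuous fun p : E n × ℝ => (O p.1, p.2) :=
    (O.continuous.comp continuous_fst).prodMk continuous_snd
  have hmaps : MapsTo (fun p : E n × ℝ => (O p.1, p.2)) (univ ×ˢ times T) (univ ×ˢ times T) :=
    fun p hp => ⟨mem_univ _, hp.2⟩
  have hgO : (fun y => g (O y)) = g := funext fun y => hg _ _ (O.norm_map y)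
  have hN : nonlin n γ (fun x t => u (O x) t) = fun x t => nonlin n γ u (O x) t := by
    ext x t; exact nonlin_comp_isometry γ O u x t
  have hD : ∀ x t, duhamelIntegrand n (fun x t => nonlin n γ u (O x) t) x t =
      duhamelIntegrand n (nonlin n γ u) (O x) t := by
    intro x t; ext s; exact duhamelIntegrand_comp_isometry hn O _ x t s
  refine ⟨hu.continuousOn.comp hO.continuousOn hmaps, fun x t ht => ?_, ?_, fun x t ht h0 => ?_,
    fun x t ht => ?_, fun x t ht s hs hst => ?_, fun x t ht => ?_, fun x t ht => ?_⟩
  · have h := hu.convolution_exists (O x) t ht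
    have h1 : (fun y : E n => ‖x - y‖ ^ (-γ) * (u (O y) t) ^ 2) =
        fun y => ‖O x - O y‖ ^ (-γ) * (u (O y) t) ^ 2 := by
      ext y; rw [← map_sub, O.norm_map]
    show Integrable (fun y : E n => ‖x - y‖ ^ (-γ) * (u (O y) t) ^ 2)
    rw [h1]
    exact integrable_comp_isometry O h
  · rw [hN]
    have h := hu.nonlin_continuousOn.comp hO.continuousOn hmaps
    simp only [Function.comp_def] at h
    exact h
  · obtain ⟨h1, h2⟩ := hu.free_defined (O x) t ht h0
    refine ⟨(waveOpDefinedAt_comp_isometry O (fun _ => 0) x t).2 h1, ?_⟩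
    have h3 := (waveOpDefinedAt_comp_isometry O (fun y => 0 + g y) x t).2 h2
    have h4 : (fun y => 0 + g (O y)) = fun y => 0 + g y := by
      ext y; rw [congrFun hgO y]
    rwa [h4] at h3
  · have h : (fun τ => waveOp n (fun _ => 0) x τ) = fun τ => waveOp n (fun _ => 0) (O x) τ :=
      funext fun τ => waveOp_comp_isometry hn O (fun _ => 0) x τ
    rw [h]
    exact hu.free_differentiable (O x) t ht
  · rw [hN]
    exact (waveOpDefinedAt_comp_isometry O (fun y => nonlin n γ u y s / (1 + s) ^ 2) x (t - s)).2
      (hu.duhamel_defined (O x) t ht s hs hst)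
  · rw [hN, hD]
    exact hu.duhamel_integrable (O x) t ht
  · rw [hu.integral_equation (O x) t ht, hN, duhamel, duhamel, hD, freeSol_zero n (by omega),
      freeSol_zero n (by omega), ← waveOp_comp_isometry hn, hgO]

/-- By uniqueness the solution with radial data is radial. -/
lemma radial_of_unique {n : ℕ} (hn : 2 ≤ n) {γ ε : ℝ} {g : E n → ℝ} (hg : Radial g)
    {T : ℝ≥0∞} {u : E n → ℝ → ℝ} (hu : IsSolution n γ (fun _ => 0) g ε T u)
    (huniq : ∀ w, IsSolution n γ (fun _ => 0) g ε T w → ∀ x, ∀ t ∈ times T, w x t = u x t)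
    {t : ℝ} (ht : t ∈ times T) : Radial fun x => u x t := by
  intro x y hxy
  obtain ⟨O, rfl⟩ := exists_isometry_apply_eq hxy
  exact (huniq _ (hu.comp_isometry hn hg O) x t ht).symm

lemma radial_nonlin {n : ℕ} {γ : ℝ} {u : E n → ℝ → ℝ} {t : ℝ} (h : Radial fun x => u x t) :
    Radial fun x => nonlin n γ u x t := by
  intro x y hxy
  obtain ⟨O, rfl⟩ := exists_isometry_apply_eq hxy
  have h1 : potential n γ u (O x) t = potential n γ u x t := by
    rw [← potential_comp_isometry]
    unfold potential
    refine integral_congr_ae (.of_forall fun y => ?_)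
    have h2 : u (O y) t = u y t := h (O y) y (O.norm_map y)
    simp only [h2]
  have h2 : u (O x) t = u x t := h (O x) x (O.norm_map x)
  simp only [nonlin, h1, h2]

lemma potential_nonneg {n : ℕ} (γ : ℝ) (u : E n → ℝ → ℝ) (x : E n) (t : ℝ) :
    0 ≤ potential n γ u x t :=
  integral_nonneg fun y => by
    have := Real.rpow_nonneg (norm_nonneg (x - y)) (-γ)
    show (0 : ℝ) ≤ _
    positivity

/-! ### Growth of the solution on a shrinking annulus. -/

/-- The annulus `ρ + t ≤ |x| ≤ 4ρ - t`. -/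
def annulus (n : ℕ) (ρ t : ℝ) : Set (E n) := {x | ρ + t ≤ ‖x‖ ∧ ‖x‖ ≤ 4 * ρ - t}

/-- The annulus shrinks at the speed of propagation, so it contains the backward light cones of its
points. -/
lemma mem_annulus_of_dist_le {n : ℕ} {ρ t s : ℝ} {x y : E n} (hx : x ∈ annulus n ρ t)
    (hxy : ‖y - x‖ ≤ t - s) : y ∈ annulus n ρ s := by
  have h := abs_le.1 ((abs_norm_sub_norm_le y x).trans hxy)
  exact ⟨by linarith [hx.1, h.1], by linarith [hx.2, h.2]⟩

lemma exists_norm_eq {n : ℕ} (hn : 1 ≤ n) {r : ℝ} (hr : 0 ≤ r) : ∃ x : E n, ‖x‖ = r := by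
  obtain ⟨k, rfl⟩ : ∃ k, n = k + 1 := ⟨n - 1, by omega⟩
  exact ⟨r • axis k, by rw [norm_smul, norm_axis, mul_one, Real.norm_of_nonneg hr]⟩

/-- The volume of the unit ball of `ℝⁿ`. -/
def unitBallVolume (n : ℕ) : ℝ := (volume : Measure (E n)).real (ball 0 1)

lemma unitBallVolume_pos (n : ℕ) : 0 < unitBallVolume n :=
  ENNReal.toReal_pos (measure_ball_pos _ _ one_pos).ne' measure_ball_lt_top.ne

/-- A single ball of radius ρ/2 centred at distance 5ρ/2 suffices: it stays in the annulus for t ≤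
ρ/4, and its points are within 8ρ of `x`. -/
lemma potential_lower_bound {n : ℕ} (hn : 1 ≤ n) {γ : ℝ} (hγ : 0 < γ) {u : E n → ℝ → ℝ}
    {ρ t c : ℝ} (hρ : 0 < ρ) (htρ : t ≤ ρ / 4) (hc : 0 ≤ c)
    (hu : ∀ y ∈ annulus n ρ t, c ≤ u y t) {x : E n} (hx : ‖x‖ ≤ 4 * ρ)
    (hint : Integrable (fun y : E n => ‖x - y‖ ^ (-γ) * (u y t) ^ 2)) :
    (8 * ρ) ^ (-γ) * (ρ / 2) ^ n * unitBallVolume n * c ^ 2 ≤ potential n γ u x t := by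
  obtain ⟨y₀, hy₀⟩ := exists_norm_eq hn (r := 5 * ρ / 2) (by positivity)
  have hball : ∀ y ∈ ball y₀ (ρ / 2), 2 * ρ ≤ ‖y‖ ∧ ‖y‖ ≤ 3 * ρ := by
    intro y hy
    rw [mem_ball, dist_eq_norm] at hy
    have h := abs_le.1 ((abs_norm_sub_norm_le y y₀).trans hy.le)
    rw [hy₀] at h
    exact ⟨by linarith [h.1], by linarith [h.2]⟩
  have hvol : (volume : Measure (E n)).real (ball y₀ (ρ / 2)) = (ρ / 2) ^ n * unitBallVolume n := by
    rw [unitBallVolume, measureReal_def, measureReal_def, Measure.addHaar_ball_of_pos _ _ (by positivity),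
      finrank_euclideanSpace_fin, ENNReal.toReal_mul, ENNReal.toReal_ofReal (by positivity)]
  have h0 : ∀ y, 0 ≤ ‖x - y‖ ^ (-γ) * (u y t) ^ 2 := fun y => by
    have := Real.rpow_nonneg (norm_nonneg (x - y)) (-γ)
    positivity
  -- At y = x the convention 0^(-γ) = 0 breaks the pointwise bound on the potential.
  have hne : ∀ᵐ y : E n, y ≠ x := by
    have : Nonempty (Fin n) := ⟨⟨0, hn⟩⟩
    exact Measure.ae_ne volume x
  calc (8 * ρ) ^ (-γ) * (ρ / 2) ^ n * unitBallVolume n * c ^ 2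
      = ∫ _ in ball y₀ (ρ / 2), (8 * ρ) ^ (-γ) * c ^ 2 := by
        rw [setIntegral_const, hvol, smul_eq_mul]; ring
    _ ≤ ∫ y in ball y₀ (ρ / 2), ‖x - y‖ ^ (-γ) * (u y t) ^ 2 := by
        refine setIntegral_mono_on_ae (integrableOn_const measure_ball_lt_top.ne) hint.integrableOn
          measurableSet_ball ?_
        filter_upwards [hne] with y hyx hy
        obtain ⟨h1, h2⟩ := hball y hy
        have h3 : c ≤ u y t := hu y ⟨by linarith, by linarith⟩
        have h4 : 0 < ‖x - y‖ := norm_pos_iff.2 (sub_ne_zero.2 hyx.symm)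
        have h5 : ‖x - y‖ ≤ 8 * ρ := (norm_sub_le x y).trans (by linarith)
        have h6 : (8 * ρ) ^ (-γ) ≤ ‖x - y‖ ^ (-γ) :=
          Real.rpow_le_rpow_of_nonpos h4 h5 (by linarith)
        have h7 : 0 ≤ (8 * ρ) ^ (-γ) := Real.rpow_nonneg (by positivity) _
        have h8 : c ^ 2 ≤ u y t ^ 2 := pow_le_pow_left₀ hc h3 2
        exact mul_le_mul h6 h8 (by positivity) (h7.trans h6)
    _ ≤ potential n γ u x t := setIntegral_le_integral hint (.of_forall h0)

/-- If the data are at least `a` on the annulus `ρ ≤ |x| ≤ 4ρ` then a radial solution cannot exist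
up to the time `δ ρ` once `ε² a²` is large compared with an explicit function of `ρ`. -/
theorem no_solution_of_large_annulus {n : ℕ} (hn : 1 ≤ n) {γ : ℝ} (hγ : 0 < γ) {κ δ : ℝ}
    (hκ : 0 < κ) (hδ : 0 < δ) (hδ4 : δ ≤ 1 / 4)
    (hW : ∀ φ : E n → ℝ, Continuous φ → (2 ≤ n → Radial φ) →
      ∀ (x : E n) (t : ℝ), 0 < t → t ≤ δ * ‖x‖ → ∀ c : ℝ, (∀ y, ‖y - x‖ ≤ t → c ≤ φ y) →
        c * (κ * t) ≤ waveOp n φ x t)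
    {g : E n → ℝ} (hg : Continuous g) (hgrad : 2 ≤ n → Radial g) {ε : ℝ} (hε : 0 < ε)
    {T : ℝ≥0∞} {u : E n → ℝ → ℝ} (hu : IsSolution n γ (fun _ => 0) g ε T u)
    (hurad : 2 ≤ n → ∀ t ∈ times T, Radial fun x => u x t)
    {ρ a : ℝ} (hρ : 1 ≤ ρ) (ha : 0 < a) (hga : ∀ y, ρ ≤ ‖y‖ → ‖y‖ ≤ 4 * ρ → a ≤ g y)
    (hT : ENNReal.ofReal (δ * ρ) < T) :
    κ * ((8 * ρ) ^ (-γ) * (ρ / 2) ^ n * unitBallVolume n) / (4 * ρ ^ 2) *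
      (ε * a * κ * (δ * ρ) / 2) ^ 2 * (δ * ρ) ^ 2 < 64 := by
  have hρ0 : 0 < ρ := by linarith
  set T₀ := δ * ρ with hT₀
  have hT₀0 : 0 < T₀ := by positivity
  have hT₀ρ : T₀ ≤ ρ / 4 := by rw [hT₀]; nlinarith
  have htimes : ∀ t, 0 ≤ t → t ≤ T₀ → t ∈ times T := fun t h0 h1 =>
    ⟨h0, (ENNReal.ofReal_le_ofReal h1).trans_lt hT⟩
  set F := nonlin n γ u with hF
  have hFcont : ∀ s ∈ times T, Continuous fun y => F y s := by
    intro s hs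
    refine continuousOn_univ.1 (hu.nonlin_continuousOn.comp (f := fun y : E n => (y, s))
      (by fun_prop) fun y _ => ⟨mem_univ _, hs⟩)
  -- On the annulus |x| ≥ ρ, so t-s ≤ δρ ≤ δ|x| puts W in its positive regime.
  have hDI : ∀ t, t ≤ T₀ → ∀ x ∈ annulus n ρ t, ∀ s, 0 ≤ s → s < t → ∀ c,
      (∀ y ∈ annulus n ρ s, c ≤ F y s / (1 + s) ^ 2) →
      c * (κ * (t - s)) ≤ duhamelIntegrand n F x t s := by
    intro t ht x hx s hs hst c hc
    have hsT := htimes s hs (by linarith)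
    refine hW _ ((hFcont s hsT).div_const _) (fun h2 y z hyz => ?_) x (t - s) (by linarith) ?_ c
      fun y hy => hc y (mem_annulus_of_dist_le hx hy)
    · have h3 : F y s = F z s := radial_nonlin (hurad h2 s hsT) y z hyz
      simp only [h3]
    · have h1 : δ * ρ ≤ δ * ‖x‖ := mul_le_mul_of_nonneg_left (by linarith [hx.1]) hδ.le
      linarith
  have heq : ∀ t, 0 < t → t ≤ T₀ → ∀ x ∈ annulus n ρ t,
      ε * a * κ * t + duhamel n F x t ≤ u x t := by
    intro t h0 ht x hx
    rw [hu.integral_equation x t (htimes t h0.le ht), freeSol_zero n hn]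
    have h1 : a * (κ * t) ≤ waveOp n g x t := by
      refine hW g hg hgrad x t h0 ?_ a fun y hy => ?_
      · have h1 : δ * ρ ≤ δ * ‖x‖ := mul_le_mul_of_nonneg_left (by linarith [hx.1]) hδ.le
        linarith
      · have := mem_annulus_of_dist_le (s := 0) hx (by simpa using hy)
        exact hga y (by linarith [this.1]) (by linarith [this.2])
    have h2 := mul_le_mul_of_nonneg_left h1 hε.le
    linarith
  have hii : ∀ t, 0 < t → t ≤ T₀ → ∀ x : E n,
      IntervalIntegrable (duhamelIntegrand n F x t) volume 0 t := fun t h0 ht x =>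
    hu.duhamel_integrable x t (htimes t h0.le ht)
  -- the space-time region
  set D : Set (E n × ℝ) := {p | p.2 ∈ Icc 0 T₀ ∧ p.1 ∈ annulus n ρ p.2} with hD
  have hDcompact : IsCompact D := by
    refine IsCompact.of_isClosed_subset
      ((isCompact_closedBall (0 : E n) (4 * ρ)).prod (isCompact_Icc (a := 0) (b := T₀))) ?_ ?_
    · have e : D = {p | 0 ≤ p.2} ∩ {p | p.2 ≤ T₀} ∩ {p | ρ + p.2 ≤ ‖p.1‖} ∩
          {p | ‖p.1‖ ≤ 4 * ρ - p.2} := by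
        ext p; simp [hD, annulus, and_assoc]
      rw [e]
      exact (((isClosed_le (by fun_prop) (by fun_prop)).inter
        (isClosed_le (by fun_prop) (by fun_prop))).inter
        (isClosed_le (by fun_prop) (by fun_prop))).inter (isClosed_le (by fun_prop) (by fun_prop))
    · rintro ⟨x, t⟩ ⟨h1, h2⟩
      refine ⟨?_, h1⟩
      rw [mem_closedBall_zero_iff]
      linarith [h2.2, h1.1]
  have hDsub : D ⊆ univ ×ˢ times T := fun p hp => ⟨mem_univ _, htimes _ hp.1.1 hp.1.2⟩
  obtain ⟨C₀, hC₀⟩ := hDcompact.exists_bound_of_continuousOn (hu.nonlin_continuousOn.mono hDsub)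
  set C := max C₀ 0
  have hC0 : 0 ≤ C := le_max_right _ _
  have hC : ∀ s, 0 ≤ s → s ≤ T₀ → ∀ y ∈ annulus n ρ s, -C ≤ F y s / (1 + s) ^ 2 := by
    intro s h0 hs y hy
    have h1 := hC₀ (y, s) ⟨⟨h0, hs⟩, hy⟩
    have h2 : |F y s| ≤ C := h1.trans (le_max_left _ _)
    have h3 := (abs_le.1 h2).1
    rw [le_div_iff₀ (by positivity)]
    nlinarith [sq_nonneg s, mul_nonneg hC0 h0, mul_nonneg hC0 (sq_nonneg s)]
  -- Positivity at the start: the free part is at least εaκt, while the Duhamel term is at least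
  -- -Cκt² whatever the sign of `u`.
  have hsmall : ∀ t, 0 < t → t ≤ T₀ → C * t < ε * a → ∀ x ∈ annulus n ρ t, 0 < u x t := by
    intro t h0 ht hCt x hx
    refine lt_of_lt_of_le ?_ (heq t h0 ht x hx)
    have h1 : ∫ _ in (0 : ℝ)..t, -(C * κ * t) ≤ duhamel n F x t := by
      refine intervalIntegral.integral_mono_on_of_le_Ioo h0.le (by simp) (hii t h0 ht x)
        fun s hs => ?_
      refine le_trans ?_ (hDI t ht x hx s hs.1.le hs.2 (-C) (hC s hs.1.le (by linarith [hs.2])))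
      have := mul_nonneg (mul_nonneg hC0 hκ.le) hs.1.le
      nlinarith
    rw [intervalIntegral.integral_const, smul_eq_mul] at h1
    have h2 : 0 < κ * t * (ε * a - C * t) := mul_pos (by positivity) (by linarith)
    nlinarith
  have hpos_step : ∀ t, 0 < t → t ≤ T₀ →
      (∀ s, 0 < s → s < t → ∀ y ∈ annulus n ρ s, 0 < u y s) → ∀ x ∈ annulus n ρ t,
      ∀ s ∈ Ioo 0 t, 0 ≤ duhamelIntegrand n F x t s := by
    intro t h0 ht hpos x hx s hs
    have := hDI t ht x hx s hs.1.le hs.2 0 fun y hy =>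
      div_nonneg (mul_nonneg (potential_nonneg γ u y s) (hpos s hs.1 hs.2 y hy).le) (by positivity)
    simpa using this
  have hlin : ∀ t, 0 < t → t ≤ T₀ →
      (∀ s, 0 < s → s < t → ∀ y ∈ annulus n ρ s, 0 < u y s) → ∀ x ∈ annulus n ρ t,
      ε * a * κ * t ≤ u x t := by
    intro t h0 ht hpos x hx
    refine le_trans ?_ (heq t h0 ht x hx)
    have h1 : ∫ _ in (0 : ℝ)..t, (0 : ℝ) ≤ duhamel n F x t :=
      intervalIntegral.integral_mono_on_of_le_Ioo h0.le (by simp) (hii t h0 ht x)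
        (hpos_step t h0 ht hpos x hx)
    rw [intervalIntegral.integral_zero] at h1
    linarith
  have hpos : ∀ t, 0 < t → t ≤ T₀ → ∀ x ∈ annulus n ρ t, 0 < u x t := by
    set τ := ε * a / (C + 1) with hτ
    have hτ0 : 0 < τ := by positivity
    have hCτ : ∀ t, t ≤ τ → C * t < ε * a := by
      intro t ht
      have h1 : C * t ≤ C * τ := mul_le_mul_of_nonneg_left ht hC0
      have h2 : (C + 1) * τ = ε * a := by rw [hτ]; field_simp
      linarith
    -- Continuation of positivity: at a point of Z with least time, `u` is positive at all earlier
    -- times in the annulus, so the linear lower bound holds and contradicts u ≤ 0. The cut at τ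
    -- keeps away from t = 0, where the initial displacement vanishes.
    set Z : Set (E n × ℝ) := {p ∈ D | u p.1 p.2 ≤ 0} ∩ {p | τ ≤ p.2} with hZ
    have hZcompact : IsCompact Z := by
      refine hDcompact.of_isClosed_subset (IsClosed.inter ?_ (isClosed_le (by fun_prop)
        (by fun_prop))) fun p hp => hp.1.1
      exact (hu.continuousOn.mono hDsub).preimage_isClosed_of_isClosed hDcompact.isClosed
        isClosed_Iic
    have hZempty : Z = ∅ := by
      by_contra hne
      obtain ⟨p, hp, hmin⟩ := hZcompact.exists_isMinOn (nonempty_iff_ne_empty.2 hne)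
        (f := fun p : E n × ℝ => p.2) (by fun_prop)
      have hp2 : 0 < p.2 := hτ0.trans_le hp.2
      have hle := hlin p.2 hp2 hp.1.1.1.2 (fun s h0 hs y hy => by
        by_contra hneg
        have hsT : s ≤ T₀ := hs.le.trans hp.1.1.1.2
        by_cases hsτ : s ≤ τ
        · exact hneg (hsmall s h0 hsT (hCτ s hsτ) y hy)
        · have hm : (y, s) ∈ Z :=
            ⟨⟨⟨⟨h0.le, hsT⟩, hy⟩, not_lt.1 hneg⟩, (not_le.1 hsτ).le⟩
          have := hmin hm
          simp only [mem_ofPred_eq] at this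
          linarith) p.1 hp.1.1.2
      have h1 : 0 < ε * a * κ * p.2 := by positivity
      linarith [hp.1.2]
    intro t h0 ht x hx
    by_contra hneg
    by_cases htτ : t ≤ τ
    · exact hneg (hsmall t h0 ht (hCτ t htτ) x hx)
    · have hm : (x, t) ∈ Z := ⟨⟨⟨⟨h0.le, ht⟩, hx⟩, not_lt.1 hneg⟩, (not_le.1 htτ).le⟩
      rw [hZempty] at hm
      exact hm
  have hdi_nonneg : ∀ t, 0 < t → t ≤ T₀ → ∀ x ∈ annulus n ρ t, ∀ s ∈ Ioo 0 t,
      0 ≤ duhamelIntegrand n F x t s := fun t h0 ht =>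
    hpos_step t h0 ht fun s hs hst => hpos s hs (by linarith)
  by_contra hbig
  rw [not_lt] at hbig
  set P := (8 * ρ) ^ (-γ) * (ρ / 2) ^ n * unitBallVolume n with hP
  have hP0 : 0 < P := by
    have := unitBallVolume_pos n
    have := Real.rpow_pos_of_pos (by positivity : 0 < 8 * ρ) (-γ)
    positivity
  -- The linear lower bound at the time T₀/2, where the doubling starts.
  set m := ε * a * κ * T₀ / 2 with hm
  have hm0 : 0 < m := by positivity
  set b := κ * P / (4 * ρ ^ 2) with hb
  have hb0 : 0 < b := by positivity
  -- Step k costs the time T₀2^{-k}/4. With M = m2^k the gain bM³(T₀2^{-k}/4)²/2 equals M·bm²T₀²/32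
  -- for every k, so the threshold 64 makes it at least 2M.
  have hgrow : ∀ k : ℕ, ∀ t, T₀ * (1 - (1 / 2) ^ (k + 1)) ≤ t → t ≤ T₀ → ∀ x ∈ annulus n ρ t,
      m * 2 ^ k ≤ u x t := by
    intro k
    induction k with
    | zero =>
      intro t h1 ht x hx
      norm_num at h1
      have h0 : 0 < t := by linarith
      have h2 := hlin t h0 ht (fun s hs hst => hpos s hs (by linarith)) x hx
      have h3 : ε * a * κ * (T₀ * (1 / 2)) ≤ ε * a * κ * t :=
        mul_le_mul_of_nonneg_left h1 (by positivity)
      rw [pow_zero, mul_one, hm]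
      linarith
    | succ k ih =>
      intro t h1 ht x hx
      set tk := T₀ * (1 - (1 / 2) ^ (k + 1)) with htk
      set M := m * 2 ^ k with hM
      have hM0 : 0 < M := by positivity
      have hhalf : (0 : ℝ) < (1 / 2) ^ k := by positivity
      have hhalf1 : ((1 : ℝ) / 2) ^ k ≤ 1 := pow_le_one₀ (by norm_num) (by norm_num)
      have htk0 : 0 < tk := by
        have : (0 : ℝ) < 1 - (1 / 2) ^ (k + 1) := by rw [pow_succ]; linarith
        positivity
      have hgap : T₀ * (1 / 2) ^ k / 4 ≤ t - tk := by
        rw [htk]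
        have : T₀ * (1 - (1 / 2) ^ (k + 1 + 1)) - T₀ * (1 - (1 / 2) ^ (k + 1)) =
          T₀ * (1 / 2) ^ k / 4 := by ring
        linarith
      have htkt : tk < t := by
        have : 0 < T₀ * (1 / 2) ^ k / 4 := by positivity
        linarith
      have h0 : 0 < t := htk0.trans htkt
      have hi1 : IntervalIntegrable (duhamelIntegrand n F x t) volume 0 tk :=
        (hii t h0 ht x).mono_set (uIcc_subset_uIcc left_mem_uIcc
          (by rw [uIcc_of_le h0.le]; exact ⟨htk0.le, htkt.le⟩))
      have hi2 : IntervalIntegrable (duhamelIntegrand n F x t) volume tk t :=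
        (hii t h0 ht x).mono_set (uIcc_subset_uIcc
          (by rw [uIcc_of_le h0.le]; exact ⟨htk0.le, htkt.le⟩) right_mem_uIcc)
      have hI1 : ∫ _ in (0 : ℝ)..tk, (0 : ℝ) ≤ ∫ s in (0 : ℝ)..tk, duhamelIntegrand n F x t s :=
        intervalIntegral.integral_mono_on_of_le_Ioo htk0.le (by simp) hi1 fun s hs =>
          hdi_nonneg t h0 ht x hx s ⟨hs.1, hs.2.trans htkt⟩
      have hI2 : ∫ s in tk..t, b * M ^ 3 * (t - s) ≤
          ∫ s in tk..t, duhamelIntegrand n F x t s := by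
        refine intervalIntegral.integral_mono_on_of_le_Ioo htkt.le
          (Continuous.intervalIntegrable (by fun_prop) _ _) hi2 fun s hs => ?_
        have hs0 : 0 < s := htk0.trans hs.1
        have hsT : s ≤ T₀ := by linarith [hs.2]
        have h2 := hDI t ht x hx s hs0.le hs.2 (P * M ^ 3 / (4 * ρ ^ 2)) fun y hy => by
          have h3 := ih s hs.1.le hsT
          have h4 := potential_lower_bound hn hγ hρ0 (hsT.trans hT₀ρ) hM0.le h3
            (x := y) (by linarith [hy.2]) (hu.convolution_exists y s (htimes s hs0.le hsT))
          have h5 : P * M ^ 3 ≤ F y s := by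
            calc P * M ^ 3 = (P * M ^ 2) * M := by ring
              _ ≤ potential n γ u y s * u y s :=
                mul_le_mul h4 (h3 y hy) hM0.le (potential_nonneg γ u y s)
          -- Here ρ ≥ 1 and s ≤ ρ/4 give 1+s ≤ 2ρ.
          have h6 : (1 + s) ^ 2 ≤ 4 * ρ ^ 2 := by nlinarith
          exact div_le_div₀ ((by positivity : 0 ≤ P * M ^ 3).trans h5) h5 (by positivity) h6
        refine le_trans (le_of_eq ?_) h2
        rw [hb]
        ring
      have hI2' : ∫ s in tk..t, b * M ^ 3 * (t - s) = b * M ^ 3 * ((t - tk) ^ 2 / 2) := by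
        rw [intervalIntegral.integral_const_mul,
          intervalIntegral.integral_comp_sub_left (fun s => s), integral_id]
        ring
      have hsplit := intervalIntegral.integral_add_adjacent_intervals hi1 hi2
      have h3 := heq t h0 ht x hx
      rw [duhamel, ← hsplit] at h3
      rw [intervalIntegral.integral_zero] at hI1
      rw [hI2'] at hI2
      have h4 : (T₀ * (1 / 2) ^ k / 4) ^ 2 ≤ (t - tk) ^ 2 := pow_le_pow_left₀ (by positivity) hgap 2
      have h5 : b * M ^ 3 * ((T₀ * (1 / 2) ^ k / 4) ^ 2 / 2) ≤ b * M ^ 3 * ((t - tk) ^ 2 / 2) :=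
        mul_le_mul_of_nonneg_left (by linarith) (by positivity)
      have h6 : b * M ^ 3 * ((T₀ * (1 / 2) ^ k / 4) ^ 2 / 2) = M * (b * m ^ 2 * T₀ ^ 2) / 32 := by
        have h7 : (2 : ℝ) ^ k * (1 / 2) ^ k = 1 := by rw [← mul_pow]; norm_num
        calc b * M ^ 3 * ((T₀ * (1 / 2) ^ k / 4) ^ 2 / 2)
            = M * (b * m ^ 2 * T₀ ^ 2) / 32 * ((2 : ℝ) ^ k * (1 / 2) ^ k) ^ 2 := by rw [hM]; ring
          _ = _ := by rw [h7]; ring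
      have h7 : M * 64 ≤ M * (b * m ^ 2 * T₀ ^ 2) := mul_le_mul_of_nonneg_left hbig hM0.le
      have h8 : 0 < ε * a * κ * t := by positivity
      have h9 : m * 2 ^ (k + 1) = 2 * M := by rw [hM]; ring
      linarith
  obtain ⟨x, hx⟩ := exists_norm_eq (n := n) hn (r := 2 * ρ) (by positivity)
  have hxD : x ∈ annulus n ρ T₀ := ⟨by linarith, by linarith⟩
  obtain ⟨k, hk⟩ := pow_unbounded_of_one_lt (u x T₀ / m) (one_lt_two : (1 : ℝ) < 2)
  have h1 := hgrow k T₀ (mul_le_of_le_one_right hT₀0.le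
    (by have : (0 : ℝ) < (1 / 2) ^ (k + 1) := by positivity
        linarith)) le_rfl x hxD
  rw [div_lt_iff₀ hm0] at hk
  linarith

end ConvWave

/-! ### Choice of the annulus and the lifespan. -/

namespace ConvWave
open Set Metric
open scoped ENNReal

/-- The lifespan is at most `(M / ε²)^{1/(n-γ-2ν)}`, as soon as this time exceeds `R` and `1`. -/
lemma exists_lifespan_le {n : ℕ} (hn : 1 ≤ n) {γ : ℝ} (hγ : 0 < γ) {A : ℝ} (hA : 0 < A)
    {g : E n → ℝ} (hg : Continuous g) (hrad : 2 ≤ n → Radial g) :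
    ∃ M : ℝ, 1 ≤ M ∧ ∀ R ν ε : ℝ, 0 < ν → ν < ((n : ℝ) - γ) / 2 →
      (∀ x : E n, R ≤ ‖x‖ → A / (1 + ‖x‖) ^ (1 + ν) ≤ g x) → 0 < ε →
      max R 1 ≤ (M / ε ^ 2) ^ (1 / ((n : ℝ) - γ - 2 * ν)) →
      lifespan n γ (fun _ => 0) g ε ≤
        ENNReal.ofReal ((M / ε ^ 2) ^ (1 / ((n : ℝ) - γ - 2 * ν))) := by
  obtain ⟨κ, δ, hκ, hδ, hδ4, hW⟩ := exists_waveOp_lower_bound hn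
  have hv := unitBallVolume_pos n
  have h8 : (0 : ℝ) < 8 ^ (-γ) := Real.rpow_pos_of_pos (by norm_num) _
  -- The coefficient of ε²ρ^d in the blow-up criterion, with 5^{2+2ν} replaced by the larger
  -- 5^{2+2n} to remove the dependence on ν.
  set c : ℝ := κ ^ 3 * 8 ^ (-γ) * (1 / 2) ^ n * unitBallVolume n * A ^ 2 * δ ^ 4 / 16 /
    5 ^ (2 + 2 * n) with hc
  have hc0 : 0 < c := by positivity
  refine ⟨max 1 (64 / c), le_max_left _ _, fun R ν ε hν hνn hgR hε hbig => ?_⟩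
  set M := max 1 (64 / c) with hM
  have hM1 : 1 ≤ M := le_max_left _ _
  have hMc : 64 ≤ c * M := by
    have : 64 / c ≤ M := le_max_right _ _
    rwa [div_le_iff₀ hc0, mul_comm] at this
  set d := (n : ℝ) - γ - 2 * ν with hd
  have hd0 : 0 < d := by rw [hd]; linarith
  set ρ := (M / ε ^ 2) ^ (1 / d) with hρ
  have hρ1 : 1 ≤ ρ := (le_max_right _ _).trans hbig
  have hρR : R ≤ ρ := (le_max_left _ _).trans hbig
  have hρ0 : 0 < ρ := by linarith
  have hρd : ρ ^ d = M / ε ^ 2 := by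
    rw [hρ, ← Real.rpow_mul (by positivity), one_div_mul_cancel hd0.ne', Real.rpow_one]
  refine sSup_le fun T hT => ?_
  obtain ⟨_, u, hu, huniq⟩ := hT
  by_contra hTρ
  rw [not_le] at hTρ
  have hT' : ENNReal.ofReal (δ * ρ) < T :=
    (ENNReal.ofReal_le_ofReal (by nlinarith)).trans_lt hTρ
  -- Since ρ ≥ 1, 1+|y| ≤ 5ρ on the annulus; ρ ≥ R makes the decay hypothesis available there.
  have hga : ∀ y : E n, ρ ≤ ‖y‖ → ‖y‖ ≤ 4 * ρ → A / (5 * ρ) ^ (1 + ν) ≤ g y := by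
    intro y h1 h2
    refine le_trans ?_ (hgR y (hρR.trans h1))
    have h3 : (1 + ‖y‖) ^ (1 + ν) ≤ (5 * ρ) ^ (1 + ν) :=
      Real.rpow_le_rpow (by positivity) (by linarith) (by linarith)
    exact div_le_div_of_nonneg_left hA.le (Real.rpow_pos_of_pos (by positivity) _) h3
  have hsmall := no_solution_of_large_annulus hn hγ hκ hδ hδ4 hW hg hrad hε hu
    (fun h2 t ht => radial_of_unique h2 (hrad h2) hu huniq ht) hρ1
    (div_pos hA (Real.rpow_pos_of_pos (by positivity) _)) hga hT'
  have e1 : (8 * ρ) ^ (-γ) = 8 ^ (-γ) * ρ ^ (-γ) := Real.mul_rpow (by norm_num) hρ0.le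
  have e2 : ((5 * ρ) ^ (1 + ν)) ^ 2 = 5 ^ (2 + 2 * ν) * (ρ ^ 2 * ρ ^ (2 * ν)) := by
    rw [← Real.rpow_natCast, ← Real.rpow_mul (by positivity), Real.mul_rpow (by norm_num) hρ0.le,
      ← Real.rpow_natCast ρ 2, ← Real.rpow_add hρ0]
    congr 2 <;> push_cast <;> ring
  have e3 : ρ ^ d = ρ ^ n * ρ ^ (-γ) / ρ ^ (2 * ν) := by
    rw [← Real.rpow_natCast ρ n, ← Real.rpow_add hρ0, ← Real.rpow_sub hρ0, hd]
    congr 1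
  have h5 : (5 : ℝ) ^ (2 + 2 * ν) ≤ 5 ^ (2 + 2 * n) := by
    rw [← Real.rpow_natCast]
    refine Real.rpow_le_rpow_of_exponent_le (by norm_num) ?_
    push_cast
    linarith
  have hq : 0 < ρ ^ (2 * ν) := Real.rpow_pos_of_pos hρ0 _
  have hq5 : (0 : ℝ) < 5 ^ (2 + 2 * ν) := Real.rpow_pos_of_pos (by norm_num) _
  have hqγ : 0 < ρ ^ (-γ) := Real.rpow_pos_of_pos hρ0 _
  -- The powers of ρ add up to (n-γ) - 2 - 2(1+ν) + 2 + 2 = n-γ-2ν, which is `d`.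
  have key : κ * ((8 * ρ) ^ (-γ) * (ρ / 2) ^ n * unitBallVolume n) / (4 * ρ ^ 2) *
      (ε * (A / (5 * ρ) ^ (1 + ν)) * κ * (δ * ρ) / 2) ^ 2 * (δ * ρ) ^ 2 =
      κ ^ 3 * 8 ^ (-γ) * (1 / 2) ^ n * unitBallVolume n * A ^ 2 * δ ^ 4 / 16 /
        5 ^ (2 + 2 * ν) * (ε ^ 2 * ρ ^ d) := by
    have e4 : (ε * (A / (5 * ρ) ^ (1 + ν)) * κ * (δ * ρ) / 2) ^ 2 =
        ε ^ 2 * A ^ 2 * κ ^ 2 * δ ^ 2 * ρ ^ 2 / 4 / ((5 * ρ) ^ (1 + ν)) ^ 2 := by ring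
    rw [e4, e1, e2, e3, div_pow ρ 2 n, one_div_pow]
    field_simp
    ring
  rw [key, hρd] at hsmall
  have h6 : c ≤ κ ^ 3 * 8 ^ (-γ) * (1 / 2) ^ n * unitBallVolume n * A ^ 2 * δ ^ 4 / 16 /
        5 ^ (2 + 2 * ν) := by
    rw [hc]
    exact div_le_div_of_nonneg_left (by positivity) hq5 h5
  have h7 : ε ^ 2 * (M / ε ^ 2) = M := by field_simp
  rw [h7] at hsmall
  have h8 := mul_le_mul_of_nonneg_right h6 (by linarith : 0 ≤ M)
  linarith

/-- Bounding the exponent `d` by `n` gives a smallness condition on ε that is uniform in ν. -/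
lemma max_one_le_rpow_of_le {n : ℕ} {R M ε d : ℝ} (hM : 1 ≤ M) (hε : 0 < ε)
    (hεR : ε ≤ 1 / max R 1 ^ n) (hd : 0 < d) (hdn : d ≤ n) :
    max R 1 ≤ (M / ε ^ 2) ^ (1 / d) := by
  have hR : 1 ≤ max R 1 := le_max_right _ _
  have hRn : 1 ≤ max R 1 ^ n := one_le_pow₀ hR
  rw [one_div, Real.le_rpow_inv_iff_of_pos (by linarith) (by positivity) hd]
  have h1 : max R 1 ^ d ≤ max R 1 ^ n := by
    rw [← Real.rpow_natCast]
    exact Real.rpow_le_rpow_of_exponent_le hR hdn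
  have h2 : max R 1 ^ n ≤ 1 / ε := (le_one_div (by linarith) hε).2 hεR
  have h3 : 1 / ε * 1 ≤ 1 / ε * (1 / ε) :=
    mul_le_mul_of_nonneg_left (hRn.trans h2) (by positivity)
  have h4 : 1 / ε * (1 / ε) ≤ M / ε ^ 2 := by
    rw [one_div_mul_one_div, ← sq]
    exact div_le_div_of_nonneg_right hM (by positivity)
  linarith

end ConvWave

end

theorem theorem2p1 (n : ℕ) (hn : 1 ≤ n) (γ : ℝ) (hγ : 0 < γ) (hγn : γ < n)
    (A : ℝ) (hA : 0 < A) (g : ConvWave.E n → ℝ) (hg : Continuous g)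
    (hrad : 2 ≤ n → ∀ x y : ConvWave.E n, ‖x‖ = ‖y‖ → g x = g y) :
    ∃ B : ℝ, 0 < B ∧ ∀ R : ℝ, 0 < R → ∃ ε₀ : ℝ, 0 < ε₀ ∧
      ∀ ν : ℝ, 0 < ν → ν < ((n : ℝ) - γ) / 2 →
        (∀ x : ConvWave.E n, R ≤ ‖x‖ → A / (1 + ‖x‖) ^ (1 + ν) ≤ g x) →
        ∀ ε : ℝ, 0 < ε → ε ≤ ε₀ →
          ConvWave.lifespan n γ (fun _ => 0) g ε ≤
            ENNReal.ofReal (B * ε ^ (-(2 / ((n : ℝ) - γ - 2 * ν)))) := by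
  obtain ⟨M, hM1, hM⟩ := ConvWave.exists_lifespan_le hn hγ hA hg hrad
  have hsplit : ∀ ε d : ℝ, 0 < ε →
      (M / ε ^ 2) ^ (1 / d) = M ^ (1 / d) * ε ^ (-(2 / d)) := by
    intro ε d hε
    rw [Real.div_rpow (by linarith) (by positivity), Real.rpow_neg hε.le, ← Real.rpow_natCast ε 2,
      ← Real.rpow_mul hε.le, div_eq_mul_inv]
    congr 3
    push_cast
    ring
  -- The natural constant M^{1/d} may blow up as d → 0, but `B` must not depend on ν or R. One
  -- admissible pair (ν₁, R₁), determined by `g`, is fixed; without such a pair the claim is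
  -- vacuous.
  by_cases hex : ∃ ν₁ R₁ : ℝ, 0 < ν₁ ∧ ν₁ < ((n : ℝ) - γ) / 2 ∧
      ∀ x : ConvWave.E n, R₁ ≤ ‖x‖ → A / (1 + ‖x‖) ^ (1 + ν₁) ≤ g x
  · obtain ⟨ν₁, R₁, hν₁, hν₁n, hg₁⟩ := hex
    set d₁ := (n : ℝ) - γ - 2 * ν₁ with hd₁
    have hd₁0 : 0 < d₁ := by rw [hd₁]; linarith
    refine ⟨M ^ (1 / d₁), Real.rpow_pos_of_pos (by linarith) _, fun R hR => ?_⟩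
    have hRpos : ∀ r : ℝ, (0 : ℝ) < 1 / max r 1 ^ n := fun r => by
      have : (0 : ℝ) < max r 1 := lt_max_of_lt_right one_pos
      positivity
    refine ⟨min (1 / max R 1 ^ n) (1 / max R₁ 1 ^ n), lt_min (hRpos R) (hRpos R₁),
      fun ν hν hνn hgν ε hε hεle => ?_⟩
    set d := (n : ℝ) - γ - 2 * ν with hd
    have hd0 : 0 < d := by rw [hd]; linarith
    have hεpow : 0 < ε ^ (-(2 / d)) := Real.rpow_pos_of_pos hε _
    -- For ν ≤ ν₁, d ≥ d₁ and M^{1/d} ≤ M^{1/d₁} because M ≥ 1. For ν ≥ ν₁ the bound for the fixed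
    -- pair (ν₁, R₁) is already stronger, as ε ≤ 1; this is why ε₀ also involves R₁.
    rcases le_total ν ν₁ with h | h
    · refine (hM R ν ε hν hνn hgν hε (ConvWave.max_one_le_rpow_of_le hM1 hε
        (hεle.trans (min_le_left _ _)) hd0 (by linarith))).trans (ENNReal.ofReal_le_ofReal ?_)
      rw [hsplit ε d hε]
      refine mul_le_mul_of_nonneg_right (Real.rpow_le_rpow_of_exponent_le hM1 ?_) hεpow.le
      exact one_div_le_one_div_of_le hd₁0 (by linarith)
    · refine (hM R₁ ν₁ ε hν₁ hν₁n hg₁ hε (ConvWave.max_one_le_rpow_of_le hM1 hε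
        (hεle.trans (min_le_right _ _)) hd₁0 (by linarith))).trans (ENNReal.ofReal_le_ofReal ?_)
      rw [hsplit ε d₁ hε]
      have hε1 : ε ≤ 1 := by
        refine hεle.trans ((min_le_left _ _).trans ?_)
        exact div_le_one_of_le₀ (one_le_pow₀ (le_max_right _ _)) (by positivity)
      refine mul_le_mul_of_nonneg_left (Real.rpow_le_rpow_of_exponent_ge hε hε1 ?_)
        (Real.rpow_nonneg (by linarith) _)
      exact neg_le_neg (div_le_div_of_nonneg_left (by norm_num) hd0 (by linarith))
  · exact ⟨1, one_pos, fun R _ => ⟨1, one_pos, fun ν hν hνn hgν =>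
      (hex ⟨ν, R, hν, hνn, hgν⟩).elim⟩⟩
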